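/- Let $n\ge 2$, let $\lambda_1,\dots,\lambda_n$ be pairwise distinct positive integers and $A=\mathrm{diag}(\lambda_1,\dots,\lambda_n)$. Let $\mathbb{R}^n\rtimes_A\mathbb{R}^+$ be the Lie group with underlying manifold $\mathbb{R}^n\times(0,\infty)$ and group law $$(x,t)\cdot(x',t')=(x+t^{A}x',\,tt'),\qquad t^{A}=e^{(\log t)A}=\mathrm{diag}(t^{\lambda_1},\dots,t^{\lambda_n}),$$ equipped with any left-invariant Riemannian metric. Then $\mathbb{R}^n\rtimes_A\mathbb{R}^+$ admits no co-compact isometric action of a discrete group: there is no group $G$ acting on $\mathbb{R}^n\rtimes_A\mathbb{R}^+$ by isometries of the Riemannian distance, properly discontinuously (for all compact sets $K,L$ only finitely many $\gamma\in G$ satisfy $\gamma K\cap L\ne\emptyset$), and with compact quotient. -/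

import Mathlib

open scoped Manifold ContDiff Bundle

noncomputable section

/-- The open upper half-space `{(x, t) : t > 0}` of `ℝⁿ × ℝ`. -/
def upperHalf (n : ℕ) : TopologicalSpace.Opens ((Fin n → ℝ) × ℝ) :=
  ⟨{p | 0 < p.2}, isOpen_lt continuous_const continuous_snd⟩

/-- The manifold underlying `ℝⁿ ⋊_A ℝ⁺`, `A = diag(lam₁, …, lamₙ)`: the open upper half-space
`ℝⁿ × ℝ⁺`. The parameter `lam` enters through the group law. -/
def Twisted {n : ℕ} (lam : Fin n → ℕ) : Type :=
  (fun _ => ↥(upperHalf n)) lam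

namespace Twisted

variable {n : ℕ} (lam : Fin n → ℕ)

instance : TopologicalSpace (Twisted lam) :=
  inferInstanceAs (TopologicalSpace ↥(upperHalf n))

instance : ChartedSpace ((Fin n → ℝ) × ℝ) (Twisted lam) :=
  inferInstanceAs (ChartedSpace ((Fin n → ℝ) × ℝ) ↥(upperHalf n))

instance : IsManifold 𝓘(ℝ, (Fin n → ℝ) × ℝ) ∞ (Twisted lam) :=
  inferInstanceAs (IsManifold 𝓘(ℝ, (Fin n → ℝ) × ℝ) ∞ ↥(upperHalf n))

variable {lam}

/-- The point `(x, t)`, `t > 0`. -/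
def mk (x : Fin n → ℝ) (t : ℝ) (ht : 0 < t) : Twisted lam := ⟨(x, t), ht⟩

/-- The coordinate `x ∈ ℝⁿ` of `(x, t)`. -/
def base (p : Twisted lam) : Fin n → ℝ := p.1.1

/-- The coordinate `t ∈ ℝ⁺` of `(x, t)`. -/
def height (p : Twisted lam) : ℝ := p.1.2

theorem height_pos (p : Twisted lam) : 0 < p.height := p.2

theorem ext' {p q : Twisted lam} (h₁ : ∀ i, p.base i = q.base i) (h₂ : p.height = q.height) :
    p = q := Subtype.ext (Prod.ext (funext h₁) h₂)

/-- The group law `(x, t) (x', t') = (x + t ^ A x', t t')`, where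
`t ^ A = exp (log t • A) = diag(t ^ lam₁, …, t ^ lamₙ)`. -/
instance : Mul (Twisted lam) :=
  ⟨fun p q => mk (fun i => p.base i + p.height ^ lam i * q.base i) (p.height * q.height)
    (mul_pos p.height_pos q.height_pos)⟩

instance : One (Twisted lam) := ⟨mk 0 1 one_pos⟩

instance : Inv (Twisted lam) :=
  ⟨fun p => mk (fun i => -((p.height⁻¹) ^ lam i * p.base i)) p.height⁻¹ (inv_pos.2 p.height_pos)⟩

@[simp] theorem base_mul (p q : Twisted lam) (i : Fin n) :
    (p * q).base i = p.base i + p.height ^ lam i * q.base i := rfl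

@[simp] theorem height_mul (p q : Twisted lam) : (p * q).height = p.height * q.height := rfl

@[simp] theorem base_one (i : Fin n) : (1 : Twisted lam).base i = 0 := rfl

@[simp] theorem height_one : (1 : Twisted lam).height = 1 := rfl

@[simp] theorem base_inv (p : Twisted lam) (i : Fin n) :
    (p⁻¹).base i = -((p.height⁻¹) ^ lam i * p.base i) := rfl

@[simp] theorem height_inv (p : Twisted lam) : (p⁻¹).height = p.height⁻¹ := rfl

instance : Group (Twisted lam) :=
  Group.ofLeftAxioms
    (fun p q r => ext' (fun i => by simp only [base_mul, height_mul]; ring)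
      (by simp only [height_mul]; ring))
    (fun p => ext' (fun i => by simp) (by simp))
    (fun p => ext' (fun i => by simp) (by simp [p.height_pos.ne']))

end Twisted

section Riemannian

variable {E : Type*} [NormedAddCommGroup E] [NormedSpace ℝ E]
  {M : Type*} [TopologicalSpace M] [ChartedSpace E M] [IsManifold 𝓘(ℝ, E) ∞ M]

variable (E M) in
/-- Smooth Riemannian metrics on the (boundaryless) smooth manifold `M` modelled on `E`. -/
abbrev SmoothRiemannianMetric :=
  Bundle.ContMDiffRiemannianMetric 𝓘(ℝ, E) ∞ E (fun p : M => TangentSpace 𝓘(ℝ, E) p)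

/-- `f : M → M` is smooth and preserves the metric tensor: `f^* g = g`. -/
structure PreservesMetric (g : SmoothRiemannianMetric E M) (f : M → M) : Prop where
  contMDiff : ContMDiff 𝓘(ℝ, E) 𝓘(ℝ, E) ∞ f
  inner_eq : ∀ (p : M) (v w : TangentSpace 𝓘(ℝ, E) p),
    g.inner (f p) (mfderiv 𝓘(ℝ, E) 𝓘(ℝ, E) f p v) (mfderiv 𝓘(ℝ, E) 𝓘(ℝ, E) f p w) =
      g.inner p v w

/-- A Riemannian metric on a group that is invariant under all left translations. -/
def IsLeftInvariantMetric [Group M] (g : SmoothRiemannianMetric E M) : Prop :=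
  ∀ a : M, PreservesMetric g (fun p => a * p)

/-- The Riemannian distance of `g`: the infimum of the `g`-lengths of the `C¹` paths from `p`
to `q`. -/
def riemannianDistOf (g : SmoothRiemannianMetric E M) (p q : M) : ENNReal :=
  letI : Bundle.RiemannianBundle (fun p : M => TangentSpace 𝓘(ℝ, E) p) := ⟨g.toRiemannianMetric⟩
  Manifold.riemannianEDist 𝓘(ℝ, E) p q

/-- The (abstract, discrete) group `G` acts on the Riemannian manifold `(M, g)` by isometries,
properly discontinuously, and with compact quotient. -/
structure IsCocompactIsometricAction (g : SmoothRiemannianMetric E M)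
    (G : Type*) [Group G] [MulAction G M] : Prop where
  isometric : ∀ (γ : G) (p q : M),
    riemannianDistOf g (γ • p) (γ • q) = riemannianDistOf g p q
  properlyDiscontinuous : ProperlyDiscontinuousSMul G M
  cocompact : CompactSpace (MulAction.orbitRel.Quotient G M)

end Riemannian

end

/-! On a large scale the space is negatively curved. All upward vertical rays run to one boundary
point ∞, and the rest of the boundary is ℝⁿ with the homogeneous quasi-distance `gauge`. For every
left-invariant metric the distance is a multiple of log `expDist` up to a bounded error
(`exists_expDist_bounds`). Upper bounds come from paths that go up, across and down; lower bounds
come from Lipschitz maps to hyperbolic planes, one for each coordinate. Hence isometries satisfy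
`CoarselyPreserves`, and only `expDist` matters from there on.

The point ∞ is coarsely fixed. If the image of an upward ray came down to some ξ in ℝⁿ, the isometry
would behave like an inversion centred at ξ (`exists_inversion`). Take its boundary values on a line
in the direction `a` of smallest weight. A coordinate of weight `lam i > lam a` is locally Hölder of
exponent `lam i / lam a > 1`, hence constant. Coordinate `a` is then continuous and injective on ℝ
with the same limit at both ends, which is impossible (`not_exists_inverted_line`). Distinctness of
the weights serves only to make the smallest one strict; n ≥ 2 leaves room for a line avoiding one
exceptional ray. So isometries change ratios of heights by a bounded factor
(`height_mul_height_le`).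

A count then excludes cocompactness (`not_exists_orbit_net`). If the orbit of 1 is a net, many orbit
points γ • 1 lie near height ε below 1. Their inverses γ⁻¹ • 1 all lie near the single point of
height 1/ε above 1, with an error independent of ε and of their number. This contradicts proper
discontinuity. -/

noncomputable section

open Set MeasureTheory Filter Topology

namespace Twisted

variable {n : ℕ} {lam : Fin n → ℕ}

/-! ### Coordinates, and the metric transported to the identity -/

/-- The inclusion of the half-space into `ℝⁿ × ℝ`. -/
def coords (p : Twisted lam) : (Fin n → ℝ) × ℝ := p.1

theorem contMDiff_coords {m : ℕ∞ω} : ContMDiff 𝓘(ℝ, (Fin n → ℝ) × ℝ) 𝓘(ℝ, (Fin n → ℝ) × ℝ) m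
    (coords : Twisted lam → _) :=
  contMDiff_subtype_val (U := upperHalf n)

theorem mfderiv_coords (p : Twisted lam) :
    mfderiv 𝓘(ℝ, (Fin n → ℝ) × ℝ) 𝓘(ℝ, (Fin n → ℝ) × ℝ) (coords : Twisted lam → _) p =
      ContinuousLinearMap.id ℝ _ :=
  mfderiv_extChartAt_self (I := 𝓘(ℝ, (Fin n → ℝ) × ℝ)) (x := p)

theorem contMDiff_of_coords {E' : Type*} [NormedAddCommGroup E'] [NormedSpace ℝ E']
    {M : Type*} [TopologicalSpace M] [ChartedSpace E' M]
    {f : M → Twisted lam}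
    (hf : ContMDiff 𝓘(ℝ, E') 𝓘(ℝ, (Fin n → ℝ) × ℝ) ∞ (fun x => coords (f x))) :
    ContMDiff 𝓘(ℝ, E') 𝓘(ℝ, (Fin n → ℝ) × ℝ) ∞ f :=
  (ContMDiff.subtypeVal_comp_iff (upperHalf n) f).1 hf

/-- The half-space is open in ℝⁿ × ℝ, so every tangent space is ℝⁿ × ℝ itself and the inclusion has
identity derivative. Derivatives of maps into the group can thus be computed in coordinates. -/
theorem mfderiv_coords_comp {E' : Type*} [NormedAddCommGroup E'] [NormedSpace ℝ E']
    {M : Type*} [TopologicalSpace M] [ChartedSpace E' M] {f : M → Twisted lam} {x : M}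
    (hf : MDifferentiableAt 𝓘(ℝ, E') 𝓘(ℝ, (Fin n → ℝ) × ℝ) f x) (v : TangentSpace 𝓘(ℝ, E') x) :
    (mfderiv 𝓘(ℝ, E') 𝓘(ℝ, (Fin n → ℝ) × ℝ) f x v : (Fin n → ℝ) × ℝ) =
      mfderiv 𝓘(ℝ, E') 𝓘(ℝ, (Fin n → ℝ) × ℝ) (fun x => coords (f x)) x v := by
  have h := mfderiv_comp_apply (I'' := 𝓘(ℝ, (Fin n → ℝ) × ℝ)) x (g := coords)
    ((contMDiff_coords (m := 1)).mdifferentiable one_ne_zero (f x)) hf v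
  rw [mfderiv_coords] at h
  exact h.symm

theorem mfderiv_mul_left_one (g : SmoothRiemannianMetric ((Fin n → ℝ) × ℝ) (Twisted lam))
    (hg : IsLeftInvariantMetric g) (p : Twisted lam) (v : (Fin n → ℝ) × ℝ) :
    (mfderiv 𝓘(ℝ, (Fin n → ℝ) × ℝ) 𝓘(ℝ, (Fin n → ℝ) × ℝ) (fun q => p * q) (1 : Twisted lam) v :
      (Fin n → ℝ) × ℝ) = (fun i => p.height ^ lam i * v.1 i, p.height * v.2) := by
  have hd : MDifferentiableAt 𝓘(ℝ, (Fin n → ℝ) × ℝ) 𝓘(ℝ, (Fin n → ℝ) × ℝ) (fun q => p * q)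
    (1 : Twisted lam) := (hg p).contMDiff.mdifferentiable (by simp) 1
  refine (mfderiv_coords_comp hd v).trans ?_
  let F : (Fin n → ℝ) × ℝ → (Fin n → ℝ) × ℝ := fun y =>
    (fun i => p.base i + p.height ^ lam i * y.1 i, p.height * y.2)
  let F' : (Fin n → ℝ) × ℝ →L[ℝ] (Fin n → ℝ) × ℝ :=
    (ContinuousLinearMap.pi fun i => (p.height ^ lam i) •
      ((ContinuousLinearMap.proj i).comp (ContinuousLinearMap.fst ℝ (Fin n → ℝ) ℝ))).prod
      (p.height • ContinuousLinearMap.snd ℝ (Fin n → ℝ) ℝ)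
  have hF : ∀ y, HasFDerivAt F F' y := by
    intro y
    refine HasFDerivAt.prodMk ?_ ?_
    · rw [hasFDerivAt_pi]
      intro i
      exact ((((ContinuousLinearMap.proj i : (Fin n → ℝ) →L[ℝ] ℝ).comp
        (ContinuousLinearMap.fst ℝ (Fin n → ℝ) ℝ)).hasFDerivAt).const_mul _).const_add _
    · exact (ContinuousLinearMap.snd ℝ (Fin n → ℝ) ℝ).hasFDerivAt.const_mul _
  have h := mfderiv_comp_apply (I'' := 𝓘(ℝ, (Fin n → ℝ) × ℝ)) (1 : Twisted lam) (g := F)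
    (f := coords) (hF _).differentiableAt.mdifferentiableAt
    ((contMDiff_coords (m := 1)).mdifferentiable one_ne_zero 1) v
  rw [mfderiv_coords, mfderiv_eq_fderiv, (hF _).fderiv] at h
  exact h

/-- The bilinear form of `g` at the identity, on `ℝⁿ × ℝ`. -/
def formOne (g : SmoothRiemannianMetric ((Fin n → ℝ) × ℝ) (Twisted lam)) :
    ((Fin n → ℝ) × ℝ) →L[ℝ] ((Fin n → ℝ) × ℝ) →L[ℝ] ℝ := g.inner (1 : Twisted lam)

/-- The tangent vector `v` at `p`, translated to the identity. -/
def pullOne (p : Twisted lam) (v : (Fin n → ℝ) × ℝ) : (Fin n → ℝ) × ℝ :=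
  (fun i => v.1 i / p.height ^ lam i, v.2 / p.height)

theorem inner_eq_formOne (g : SmoothRiemannianMetric ((Fin n → ℝ) × ℝ) (Twisted lam))
    (hg : IsLeftInvariantMetric g) (p : Twisted lam) (v w : (Fin n → ℝ) × ℝ) :
    g.inner p v w = formOne g (pullOne p v) (pullOne p w) := by
  have h := (hg p).inner_eq 1 (pullOne p v) (pullOne p w)
  have hp := p.height_pos.ne'
  have key : ∀ u : (Fin n → ℝ) × ℝ, (mfderiv 𝓘(ℝ, (Fin n → ℝ) × ℝ) 𝓘(ℝ, (Fin n → ℝ) × ℝ)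
      (fun q => p * q) (1 : Twisted lam) (pullOne p u) : (Fin n → ℝ) × ℝ) = u := by
    intro u
    refine (mfderiv_mul_left_one g hg p _).trans ?_
    refine Prod.ext (funext fun i => ?_) ?_
    · simp only [pullOne]; field_simp
    · simp only [pullOne]; field_simp
  -- The fibres over `p * 1` and `p` are the same vector space, so only the base point needs
  -- rewriting.
  have e : ∀ q : Twisted lam, q = p → g.inner q v w = g.inner p v w := by rintro _ rfl; rfl
  rw [← e (p * 1) (mul_one p)]
  refine Eq.trans ?_ h
  have h1 := key v
  have h2 := key w
  exact (congrArg₂ (fun a b : (Fin n → ℝ) × ℝ => g.inner (p * 1) a b) h1 h2).symm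

/-! ### Distance bounds from gradients and paths, and the quadratic form at the identity -/

/-- Source of all lower bounds on the distance: integrate the derivative of `F` along an almost
minimizing path. Regularity on the open half-space suffices, which admits logarithms of the height.
-/
theorem enorm_sub_le_riemannianDistOf
    (g : SmoothRiemannianMetric ((Fin n → ℝ) × ℝ) (Twisted lam))
    {F : (Fin n → ℝ) × ℝ → ℝ} (hF : ContDiffOn ℝ 1 F {y | 0 < y.2}) {c : ℝ} (hc : 0 < c)
    (hb : ∀ (p : Twisted lam) (v : (Fin n → ℝ) × ℝ),
      (fderiv ℝ F (coords p) v) ^ 2 ≤ c ^ 2 * g.inner p v v) (p q : Twisted lam) :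
    ‖F (coords q) - F (coords p)‖ₑ ≤ ENNReal.ofReal c * riemannianDistOf g p q := by
  let _ : Bundle.RiemannianBundle (fun p : Twisted lam => TangentSpace 𝓘(ℝ, (Fin n → ℝ) × ℝ) p) :=
    ⟨g.toRiemannianMetric⟩
  have hopen : IsOpen {y : (Fin n → ℝ) × ℝ | 0 < y.2} := isOpen_lt continuous_const continuous_snd
  have hb' : ∀ (p : Twisted lam) (v : TangentSpace 𝓘(ℝ, (Fin n → ℝ) × ℝ) p),
      ‖fderiv ℝ F (coords p) v‖ₑ ≤ ENNReal.ofReal c * ‖v‖ₑ := by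
    intro p v
    rw [← ofReal_norm, ← ofReal_norm, ← ENNReal.ofReal_mul hc.le]
    apply ENNReal.ofReal_le_ofReal
    rw [norm_eq_sqrt_real_inner v, Real.norm_eq_abs]
    rw [← abs_of_nonneg (mul_nonneg hc.le (Real.sqrt_nonneg _))]
    apply sq_le_sq.1
    rw [mul_pow, Real.sq_sqrt real_inner_self_nonneg]
    exact hb p v
  have main : ∀ r, Manifold.riemannianEDist 𝓘(ℝ, (Fin n → ℝ) × ℝ) p q < r →
      ‖F (coords q) - F (coords p)‖ₑ ≤ ENNReal.ofReal c * r := by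
    intro r hr
    obtain ⟨η, h0, h1, hη, hl⟩ := Manifold.exists_lt_of_riemannianEDist_lt hr
    refine le_trans ?_ (mul_le_mul_right hl.le _)
    have hFη : ContDiffOn ℝ 1 (fun t => F (coords (η t))) (Icc 0 1) := by
      refine hF.comp (contMDiffOn_iff_contDiffOn.1 (contMDiff_coords.comp_contMDiffOn hη)) ?_
      intro t _
      exact (η t).height_pos
    have := enorm_sub_le_lintegral_derivWithin_Icc_of_contDiffOn_Icc hFη zero_le_one
    simp only [h0, h1] at this
    refine this.trans ?_
    rw [Manifold.pathELength_eq_lintegral_mfderivWithin_Icc, ← lintegral_const_mul' _ _ (by simp)]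
    refine setLIntegral_mono' measurableSet_Icc fun t ht => ?_
    refine le_trans (le_of_eq ?_) (hb' (η t) _)
    congr 1
    have hu : UniqueDiffWithinAt ℝ (Icc (0:ℝ) 1) t := uniqueDiffOn_Icc zero_lt_one t ht
    have hηd := hη.mdifferentiableOn one_ne_zero t ht
    have hcd := (contMDiff_coords (lam := lam) (m := 1)).mdifferentiable one_ne_zero (η t)
    have hFd : DifferentiableAt ℝ F (coords (η t)) :=
      (hF.differentiableOn one_ne_zero).differentiableAt (hopen.mem_nhds (η t).height_pos)
    have e1 := hcd.hasMFDerivAt.comp_hasMFDerivWithinAt t hηd.hasMFDerivWithinAt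
    rw [mfderiv_coords] at e1
    have e2 := hFd.hasFDerivAt.comp_hasFDerivWithinAt t e1.hasFDerivWithinAt
    exact e2.hasDerivWithinAt.derivWithin hu
  unfold riemannianDistOf
  have hc0 : ENNReal.ofReal c ≠ 0 := (ENNReal.ofReal_pos.2 hc).ne'
  refine (ENNReal.div_le_iff' hc0 ENNReal.ofReal_ne_top).1 (le_of_forall_gt_imp_ge_of_dense ?_)
  exact fun r hr => (ENNReal.div_le_iff' hc0 ENNReal.ofReal_ne_top).2 (main r hr)

/-- Source of all upper bounds: an explicit curve of bounded speed, with velocity read in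
coordinates. -/
theorem riemannianDistOf_le_of_path
    (g : SmoothRiemannianMetric ((Fin n → ℝ) × ℝ) (Twisted lam))
    {σ : ℝ → Twisted lam} {σ' : ℝ → (Fin n → ℝ) × ℝ}
    (hσ : ContDiff ℝ ∞ fun τ => coords (σ τ))
    (hσ' : ∀ τ, HasDerivAt (fun τ => coords (σ τ)) (σ' τ) τ) {a b c : ℝ} (hab : a ≤ b)
    (hc : 0 ≤ c) (hb : ∀ τ ∈ Icc a b, g.inner (σ τ) (σ' τ) (σ' τ) ≤ c ^ 2) :
    riemannianDistOf g (σ a) (σ b) ≤ ENNReal.ofReal (c * (b - a)) := by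
  let _ : Bundle.RiemannianBundle (fun p : Twisted lam => TangentSpace 𝓘(ℝ, (Fin n → ℝ) × ℝ) p) :=
    ⟨g.toRiemannianMetric⟩
  have hσm : ContMDiff 𝓘(ℝ, ℝ) 𝓘(ℝ, (Fin n → ℝ) × ℝ) ∞ σ :=
    contMDiff_of_coords (contMDiff_iff_contDiff.2 hσ)
  unfold riemannianDistOf
  refine (Manifold.riemannianEDist_le_pathELength (hσm.of_le (by simp)).contMDiffOn rfl rfl
    hab).trans ?_
  rw [Manifold.pathELength_eq_lintegral_mfderiv_Icc]
  have hd : ∀ τ, (mfderiv 𝓘(ℝ, ℝ) 𝓘(ℝ, (Fin n → ℝ) × ℝ) σ τ (1 : ℝ) : (Fin n → ℝ) × ℝ) = σ' τ := by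
    intro τ
    refine (mfderiv_coords_comp (hσm.mdifferentiable (by simp) τ) (1 : ℝ)).trans ?_
    rw [mfderiv_eq_fderiv]
    exact (hσ' τ).deriv
  have hle : ∀ τ ∈ Icc a b, ‖mfderiv 𝓘(ℝ, ℝ) 𝓘(ℝ, (Fin n → ℝ) × ℝ) σ τ (1 : ℝ)‖ₑ ≤
      ENNReal.ofReal c := by
    intro τ hτ
    rw [← ofReal_norm]
    apply ENNReal.ofReal_le_ofReal
    rw [norm_eq_sqrt_real_inner]
    refine Real.sqrt_le_iff.2 ⟨hc, ?_⟩
    refine le_trans (le_of_eq ?_) (hb τ hτ)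
    exact (congrArg₂ (fun a b : (Fin n → ℝ) × ℝ => g.inner (σ τ) a b) (hd τ) (hd τ))
  refine (setLIntegral_mono' measurableSet_Icc hle).trans (le_of_eq ?_)
  rw [setLIntegral_const, Real.volume_Icc, ENNReal.ofReal_mul hc]

set_option synthInstance.maxHeartbeats 200000 in
-- The form restricted to ℝⁿ × 0 is positive definite, so some `v` makes (v, 1) orthogonal to ℝⁿ ×
-- 0; the splitting is Pythagoras and `c` is the length of (v, 1). The constants `k` and `K` compare
-- the restricted form with the coordinate norm.
theorem exists_formOne_bounds (g : SmoothRiemannianMetric ((Fin n → ℝ) × ℝ) (Twisted lam)) :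
    ∃ (v : Fin n → ℝ) (c k K : ℝ), 0 < c ∧ 0 < k ∧ 0 ≤ K ∧
      (∀ y s, formOne g (y, s) (y, s) =
        formOne g (y - s • v, 0) (y - s • v, 0) + c ^ 2 * s ^ 2) ∧
      (∀ y i, k ^ 2 * y i ^ 2 ≤ formOne g (y, 0) (y, 0)) ∧
      ∀ y, formOne g (y, 0) (y, 0) ≤ K ^ 2 * ‖y‖ ^ 2 := by
  set Q := formOne g with hQ
  have symm : ∀ a b, Q a b = Q b a := g.symm (1 : Twisted lam)
  have pos : ∀ a, a ≠ 0 → 0 < Q a a := g.pos (1 : Twisted lam)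
  have nonneg : ∀ a, 0 ≤ Q a a := fun a => by
    rcases eq_or_ne a 0 with rfl | h
    · simp
    · exact (pos a h).le
  have bdd : Bornology.IsVonNBounded ℝ {a : (Fin n → ℝ) × ℝ | Q a a < 1} :=
    g.isVonNBounded (1 : Twisted lam)
  obtain ⟨R, hR⟩ := (NormedSpace.isVonNBounded_iff' ℝ).1 bdd
  have hR0 : 0 ≤ R := (norm_nonneg _).trans (hR 0 (by simp))
  -- Dividing `a` by 2√(Q a a) gives a vector of Q-value 1/4, inside the bounded unit ball. The
  -- extra 1 keeps the constant positive when R = 0.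
  have low : ∀ a, ‖a‖ ≤ (2 * R + 1) * √(Q a a) := by
    intro a
    rcases eq_or_ne a 0 with rfl | h
    · simp
    have hq := Real.sqrt_pos.2 (pos a h)
    have h1 := hR ((2 * √(Q a a))⁻¹ • a) (by
      simp only [map_smul, smul_apply, smul_eq_mul, mem_ofPred_eq]
      have := Real.mul_self_sqrt (nonneg a)
      calc _ = (2 * √(Q a a))⁻¹ * ((2 * √(Q a a))⁻¹ * (√(Q a a) * √(Q a a))) := by rw [this]
        _ = 1 / 4 := by field_simp; norm_num
        _ < 1 := by norm_num)
    rw [norm_smul, norm_inv, Real.norm_of_nonneg (by positivity),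
      inv_mul_le_iff₀ (by positivity)] at h1
    nlinarith
  -- the normal direction
  have add1 : ∀ a b : Fin n → ℝ, ((a + b, 0) : (Fin n → ℝ) × ℝ) = (a, 0) + (b, 0) := by simp
  have smul1 : ∀ (r : ℝ) (a : Fin n → ℝ), ((r • a, 0) : (Fin n → ℝ) × ℝ) = r • (a, 0) := by simp
  let B : (Fin n → ℝ) →ₗ[ℝ] Module.Dual ℝ (Fin n → ℝ) :=
    LinearMap.mk₂ ℝ (fun x y => Q (x, 0) (y, 0))
      (fun a b c => by rw [add1, map_add, add_apply])
      (fun a b c => by rw [smul1, map_smul, smul_apply])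
      (fun a b c => by rw [add1, map_add])
      (fun a b c => by rw [smul1, map_smul])
  have hinj : Function.Injective B := by
    rw [← LinearMap.ker_eq_bot, LinearMap.ker_eq_bot']
    intro m hm
    by_contra hne
    have h1 : Q (m, 0) (m, 0) = 0 := by
      have := LinearMap.congr_fun hm m
      simpa [B] using this
    have := pos (m, 0) (by simpa using hne)
    linarith
  have hsurj := (LinearMap.injective_iff_surjective_of_finrank_eq_finrank
    (Subspace.dual_finrank_eq (K := ℝ) (V := Fin n → ℝ)).symm).1 hinj
  let ℓ : Module.Dual ℝ (Fin n → ℝ) :=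
    { toFun := fun y => - Q (0, 1) (y, 0)
      map_add' := fun b c => by rw [add1, map_add, neg_add]
      map_smul' := fun a c => by rw [smul1, map_smul, smul_neg, RingHom.id_apply] }
  obtain ⟨v, hv⟩ := hsurj ℓ
  have orth : ∀ y, Q (v, 1) (y, 0) = 0 := by
    intro y
    have h1 : Q (v, 0) (y, 0) = - Q (0, 1) (y, 0) := LinearMap.congr_fun hv y
    rw [show ((v, 1) : (Fin n → ℝ) × ℝ) = (v, 0) + (0, 1) by simp, map_add, add_apply, h1,
      neg_add_cancel]
  have hc := pos (v, 1) (by simp)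
  refine ⟨v, √(Q (v, 1) (v, 1)), (2 * R + 1)⁻¹, √‖Q‖, Real.sqrt_pos.2 hc, by positivity,
    by positivity, ?_, ?_, ?_⟩
  · intro y s
    have h0 : ((y, s) : (Fin n → ℝ) × ℝ) = (y - s • v, 0) + s • (v, 1) := by simp
    rw [Real.sq_sqrt hc.le, h0]
    simp only [map_add, add_apply, map_smul, smul_apply,
      smul_eq_mul, orth, symm (y - s • v, 0) (v, 1)]
    ring
  · intro y i
    have h1 := low (y, 0)
    have h2 : |y i| ≤ ‖((y, 0) : (Fin n → ℝ) × ℝ)‖ := by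
      simpa using norm_le_pi_norm y i
    have h3 := pow_le_pow_left₀ (abs_nonneg _) (h2.trans h1) 2
    rw [mul_pow, Real.sq_sqrt (nonneg _), sq_abs] at h3
    rw [inv_pow, inv_mul_le_iff₀ (by positivity)]
    exact h3
  · intro y
    rw [Real.sq_sqrt (norm_nonneg Q)]
    have := Q.le_opNorm₂ (y, 0) (y, 0)
    have h2 : ‖((y, 0) : (Fin n → ℝ) × ℝ)‖ = ‖y‖ := by simp
    rw [h2] at this
    refine (le_abs_self _).trans (this.trans (by rw [sq, mul_assoc]))

/-! ### The model distance: `gauge`, `apex` and `expDist` -/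

/-- The homogeneous quasi-distance `maxᵢ |xᵢ - yᵢ| ^ (1 / lamᵢ)` on `ℝⁿ`. -/
def gauge (lam : Fin n → ℕ) (x y : Fin n → ℝ) : ℝ := ‖fun i => |x i - y i| ^ ((lam i : ℝ)⁻¹)‖

/-- The height at which the vertical rays through `p` and `q` come together. -/
def apex (p q : Twisted lam) : ℝ := max (max p.height q.height) (gauge lam p.base q.base)

/-- A multiplicative model of the distance: up to constants its logarithm is proportional to the
distance of any left-invariant metric. -/
def expDist (p q : Twisted lam) : ℝ := apex p q ^ 2 / (p.height * q.height)

theorem gauge_nonneg (x y : Fin n → ℝ) : 0 ≤ gauge lam x y := norm_nonneg _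

theorem gauge_comm (x y : Fin n → ℝ) : gauge lam x y = gauge lam y x := by
  unfold gauge; simp only [abs_sub_comm]

theorem gauge_le_iff (hpos : ∀ i, 0 < lam i) {x y : Fin n → ℝ} {r : ℝ} (hr : 0 ≤ r) :
    gauge lam x y ≤ r ↔ ∀ i, |x i - y i| ≤ r ^ lam i := by
  unfold gauge
  rw [pi_norm_le_iff_of_nonneg hr]
  refine forall_congr' fun i => ?_
  have hi : (0 : ℝ) < lam i := by exact_mod_cast hpos i
  rw [Real.norm_of_nonneg (by positivity), Real.rpow_inv_le_iff_of_pos (abs_nonneg _) hr hi,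
    Real.rpow_natCast]

theorem abs_sub_le_gauge_pow (hpos : ∀ i, 0 < lam i) (x y : Fin n → ℝ) (i : Fin n) :
    |x i - y i| ≤ gauge lam x y ^ lam i :=
  (gauge_le_iff hpos (gauge_nonneg x y)).1 le_rfl i

/-- With m the maximum, the i-th difference is at most 2 m ^ lam i ≤ (2 m) ^ lam i, because every
weight is at least 1. -/
theorem gauge_triangle (hpos : ∀ i, 0 < lam i) (x y z : Fin n → ℝ) :
    gauge lam x z ≤ 2 * max (gauge lam x y) (gauge lam y z) := by
  have h0 : 0 ≤ max (gauge lam x y) (gauge lam y z) := le_max_of_le_left (gauge_nonneg _ _)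
  rw [gauge_le_iff hpos (by positivity)]
  intro i
  have h1 := (abs_sub_le_gauge_pow hpos x y i).trans
    (pow_le_pow_left₀ (gauge_nonneg _ _) (le_max_left _ (gauge lam y z)) _)
  have h2 := (abs_sub_le_gauge_pow hpos y z i).trans
    (pow_le_pow_left₀ (gauge_nonneg _ _) (le_max_right (gauge lam x y) _) _)
  have h3 : (2 : ℝ) ≤ 2 ^ lam i := by
    simpa using pow_le_pow_right₀ (one_le_two (α := ℝ)) (hpos i)
  have h4 := pow_nonneg h0 (lam i)
  rw [mul_pow]
  have := abs_sub_le (x i) (y i) (z i)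
  nlinarith

theorem gauge_eq_zero_iff (hpos : ∀ i, 0 < lam i) {x y : Fin n → ℝ} :
    gauge lam x y = 0 ↔ x = y := by
  constructor
  · intro h
    funext i
    have := abs_sub_le_gauge_pow hpos x y i
    rw [h, zero_pow (hpos i).ne'] at this
    exact sub_eq_zero.1 (abs_nonpos_iff.1 this)
  · rintro rfl
    refine le_antisymm ((gauge_le_iff hpos le_rfl).2 fun i => ?_) (gauge_nonneg _ _)
    simp [(hpos i).ne']

theorem continuous_gauge :
    Continuous fun z : (Fin n → ℝ) × (Fin n → ℝ) => gauge lam z.1 z.2 := by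
  unfold gauge
  refine continuous_norm.comp (continuous_pi fun i => ?_)
  refine Continuous.rpow_const (by fun_prop) fun _ => Or.inr (by positivity)

theorem apex_comm (p q : Twisted lam) : apex p q = apex q p := by
  unfold apex; rw [max_comm p.height, gauge_comm]

theorem height_le_apex_left (p q : Twisted lam) : p.height ≤ apex p q :=
  (le_max_left _ _).trans (le_max_left _ _)

theorem height_le_apex_right (p q : Twisted lam) : q.height ≤ apex p q :=
  (le_max_right _ _).trans (le_max_left _ _)

theorem gauge_le_apex (p q : Twisted lam) : gauge lam p.base q.base ≤ apex p q :=
  le_max_right _ _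

theorem apex_pos (p q : Twisted lam) : 0 < apex p q :=
  p.height_pos.trans_le (height_le_apex_left p q)

theorem apex_le_iff {p q : Twisted lam} {r : ℝ} :
    apex p q ≤ r ↔ p.height ≤ r ∧ q.height ≤ r ∧ gauge lam p.base q.base ≤ r := by
  simp only [apex, max_le_iff, and_assoc]

theorem apex_triangle (hpos : ∀ i, 0 < lam i) (p q r : Twisted lam) :
    apex p r ≤ 2 * max (apex p q) (apex q r) := by
  have h1 := le_max_left (apex p q) (apex q r)
  have h2 := le_max_right (apex p q) (apex q r)
  have h3 := apex_pos p q
  refine apex_le_iff.2 ⟨?_, ?_, ?_⟩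
  · linarith [height_le_apex_left p q]
  · linarith [height_le_apex_right q r]
  · refine (gauge_triangle hpos _ q.base _).trans ?_
    have := max_le_max (gauge_le_apex p q) (gauge_le_apex q r)
    linarith

theorem expDist_pos (p q : Twisted lam) : 0 < expDist p q :=
  div_pos (pow_pos (apex_pos p q) 2) (mul_pos p.height_pos q.height_pos)

theorem one_le_expDist (p q : Twisted lam) : 1 ≤ expDist p q := by
  unfold expDist
  rw [one_le_div (mul_pos p.height_pos q.height_pos), sq]
  exact mul_le_mul (height_le_apex_left p q) (height_le_apex_right p q) q.height_pos.le
    (apex_pos p q).le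

theorem apex_sq (p q : Twisted lam) : apex p q ^ 2 = expDist p q * (p.height * q.height) :=
  (div_mul_cancel₀ _ (mul_pos p.height_pos q.height_pos).ne').symm

theorem expDist_comm (p q : Twisted lam) : expDist p q = expDist q p := by
  unfold expDist; rw [apex_comm, mul_comm p.height]

/-- The larger of the two apexes is at least half of `apex p r`, and the smaller one is at least the
height of `q`. Squaring turns the factor 2 into 4. -/
theorem expDist_triangle (hpos : ∀ i, 0 < lam i) (p q r : Twisted lam) :
    expDist p r ≤ 4 * (expDist p q * expDist q r) := by
  have hp := p.height_pos
  have hq := q.height_pos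
  have hr := r.height_pos
  have h1 : apex p r * q.height ≤ 2 * (apex p q * apex q r) := by
    rcases le_total (apex p q) (apex q r) with h | h
    · have := apex_triangle hpos p q r
      rw [max_eq_right h] at this
      calc _ ≤ (2 * apex q r) * apex p q :=
            mul_le_mul this (height_le_apex_right p q) hq.le (by linarith [apex_pos q r])
        _ = _ := by ring
    · have := apex_triangle hpos p q r
      rw [max_eq_left h] at this
      calc _ ≤ (2 * apex p q) * apex q r :=
            mul_le_mul this (height_le_apex_left q r) hq.le (by linarith [apex_pos p q])
        _ = _ := by ring
  have h2 := pow_le_pow_left₀ (mul_pos (apex_pos p r) hq).le h1 2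
  unfold expDist
  rw [div_mul_div_comm, ← mul_div_assoc, div_le_div_iff₀ (by positivity) (by positivity)]
  have h3 : 0 ≤ p.height * r.height := by positivity
  calc apex p r ^ 2 * (p.height * q.height * (q.height * r.height))
      = (apex p r * q.height) ^ 2 * (p.height * r.height) := by ring
    _ ≤ (2 * (apex p q * apex q r)) ^ 2 * (p.height * r.height) :=
        mul_le_mul_of_nonneg_right h2 h3
    _ = _ := by ring

/-! ### Upper bound for the distance: up, across and down -/

theorem riemannianDistOf_comm (g : SmoothRiemannianMetric ((Fin n → ℝ) × ℝ) (Twisted lam))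
    (p q : Twisted lam) : riemannianDistOf g p q = riemannianDistOf g q p := by
  let _ : Bundle.RiemannianBundle
    (fun p : Twisted lam => TangentSpace 𝓘(ℝ, (Fin n → ℝ) × ℝ) p) := ⟨g.toRiemannianMetric⟩
  exact Manifold.riemannianEDist_comm

theorem riemannianDistOf_triangle (g : SmoothRiemannianMetric ((Fin n → ℝ) × ℝ) (Twisted lam))
    (p q r : Twisted lam) :
    riemannianDistOf g p r ≤ riemannianDistOf g p q + riemannianDistOf g q r := by
  let _ : Bundle.RiemannianBundle
    (fun p : Twisted lam => TangentSpace 𝓘(ℝ, (Fin n → ℝ) × ℝ) p) := ⟨g.toRiemannianMetric⟩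
  exact Manifold.riemannianEDist_triangle

theorem eventually_riemannianDistOf_lt
    (g : SmoothRiemannianMetric ((Fin n → ℝ) × ℝ) (Twisted lam))
    (p : Twisted lam) {r : ENNReal} (hr : 0 < r) :
    ∀ᶠ q in 𝓝 p, riemannianDistOf g p q < r := by
  let _ : Bundle.RiemannianBundle
    (fun p : Twisted lam => TangentSpace 𝓘(ℝ, (Fin n → ℝ) × ℝ) p) := ⟨g.toRiemannianMetric⟩
  have : IsManifold 𝓘(ℝ, (Fin n → ℝ) × ℝ) 1 (Twisted lam) := IsManifold.of_le (n := ∞) (by simp)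
  have : IsContinuousRiemannianBundle ((Fin n → ℝ) × ℝ)
      (fun p : Twisted lam => TangentSpace 𝓘(ℝ, (Fin n → ℝ) × ℝ) p) :=
    ⟨g.inner, g.contMDiff.continuous, fun _ _ _ => rfl⟩
  exact eventually_riemannianEDist_lt 𝓘(ℝ, (Fin n → ℝ) × ℝ) p hr

/-- The point at height `t` on the integral curve through `p` of the left-invariant vector field
with value `(v, 1)` at the identity. -/
def flowTo (v : Fin n → ℝ) (p : Twisted lam) (t : ℝ) (ht : 0 < t) : Twisted lam :=
  mk (fun i => p.base i + v i / lam i * (t ^ lam i - p.height ^ lam i)) t ht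

/-- Parametrized by τ = log t, the flow line has velocity the left translate of (v, 1), so its speed
is at most `c`. -/
theorem riemannianDistOf_flowTo_le (hpos : ∀ i, 0 < lam i)
    (g : SmoothRiemannianMetric ((Fin n → ℝ) × ℝ) (Twisted lam))
    (hg : IsLeftInvariantMetric g) {v : Fin n → ℝ} {c : ℝ} (hc : 0 ≤ c)
    (hv : formOne g (v, 1) (v, 1) ≤ c ^ 2) (p : Twisted lam) {t : ℝ} (ht : p.height ≤ t) :
    riemannianDistOf g p (flowTo v p t (p.height_pos.trans_le ht)) ≤
      ENNReal.ofReal (c * (Real.log t - Real.log p.height)) := by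
  have ht0 := p.height_pos.trans_le ht
  let σ : ℝ → Twisted lam := fun τ => flowTo v p (Real.exp τ) (Real.exp_pos τ)
  have h := riemannianDistOf_le_of_path g (σ := σ) (a := Real.log p.height) (b := Real.log t)
    (σ' := fun τ => (fun i => v i * Real.exp τ ^ lam i, Real.exp τ)) ?_ ?_
    (Real.log_le_log p.height_pos ht) hc ?_
  · have e1 : σ (Real.log p.height) = p := by
      refine ext' (fun i => ?_) (Real.exp_log p.height_pos)
      simp [σ, flowTo, mk, base, Real.exp_log p.height_pos]
    have e2 : σ (Real.log t) = flowTo v p t ht0 := by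
      simp only [σ, Real.exp_log ht0]
    rwa [e1, e2] at h
  · change ContDiff ℝ ∞ fun τ => ((fun i => p.base i + v i / lam i *
      (Real.exp τ ^ lam i - p.height ^ lam i), Real.exp τ) : (Fin n → ℝ) × ℝ)
    refine ContDiff.prodMk (contDiff_pi.2 fun i => ?_) Real.contDiff_exp
    fun_prop
  · intro τ
    change HasDerivAt (fun τ => ((fun i => p.base i + v i / lam i *
      (Real.exp τ ^ lam i - p.height ^ lam i), Real.exp τ) : (Fin n → ℝ) × ℝ)) _ τ
    refine HasDerivAt.prodMk (hasDerivAt_pi.2 fun i => ?_) (Real.hasDerivAt_exp τ)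
    have hi : (lam i : ℝ) ≠ 0 := by exact_mod_cast (hpos i).ne'
    refine (((((Real.hasDerivAt_exp τ).pow (lam i)).sub_const _).const_mul
      _).const_add _).congr_deriv ?_
    have : Real.exp τ ^ lam i = Real.exp τ ^ (lam i - 1) * Real.exp τ := by
      rw [← pow_succ, Nat.sub_add_cancel (hpos i)]
    rw [this]
    field_simp
  · intro τ _
    rw [inner_eq_formOne g hg]
    have : pullOne (σ τ) (fun i => v i * Real.exp τ ^ lam i, Real.exp τ) = (v, 1) := by
      refine Prod.ext (funext fun i => ?_) ?_
      · exact mul_div_cancel_right₀ _ (pow_pos (Real.exp_pos τ) _).ne'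
      · exact div_self (Real.exp_pos τ).ne'
    rw [this]
    exact hv

/-- Follow the straight horizontal segment: translating its velocity to the identity divides
coordinate i by height ^ lam i. -/
theorem riemannianDistOf_le_of_height_eq
    (g : SmoothRiemannianMetric ((Fin n → ℝ) × ℝ) (Twisted lam))
    (hg : IsLeftInvariantMetric g) {K M : ℝ} (hK : 0 ≤ K) (hM : 0 ≤ M)
    (hQ : ∀ y, formOne g (y, 0) (y, 0) ≤ K ^ 2 * ‖y‖ ^ 2) {p q : Twisted lam}
    (h : p.height = q.height) (hb : ∀ i, |p.base i - q.base i| ≤ M * p.height ^ lam i) :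
    riemannianDistOf g p q ≤ ENNReal.ofReal (K * M) := by
  let σ : ℝ → Twisted lam := fun τ =>
    mk (fun i => p.base i + τ * (q.base i - p.base i)) p.height p.height_pos
  have h' := riemannianDistOf_le_of_path g (σ := σ) (a := 0) (b := 1)
    (σ' := fun τ => (fun i => q.base i - p.base i, 0)) (c := K * M) ?_ ?_
    zero_le_one (by positivity) ?_
  · have e1 : σ 0 = p := ext' (fun i => by simp [σ, mk, base]) rfl
    have e2 : σ 1 = q := ext' (fun i => by simp [σ, mk, base]) h
    rwa [e1, e2, sub_zero, mul_one] at h'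
  · change ContDiff ℝ ∞ fun τ : ℝ => ((fun i => p.base i + τ * (q.base i - p.base i),
      p.height) : (Fin n → ℝ) × ℝ)
    refine ContDiff.prodMk (contDiff_pi.2 fun i => ?_) contDiff_const
    fun_prop
  · intro τ
    change HasDerivAt (fun τ : ℝ => ((fun i => p.base i + τ * (q.base i - p.base i),
      p.height) : (Fin n → ℝ) × ℝ)) _ τ
    refine HasDerivAt.prodMk (hasDerivAt_pi.2 fun i => ?_) (hasDerivAt_const _ _)
    exact (((hasDerivAt_id τ).mul_const _).const_add _).congr_deriv (one_mul _)
  · intro τ _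
    rw [inner_eq_formOne g hg]
    have : pullOne (σ τ) (fun i => q.base i - p.base i, 0) =
        (fun i => (q.base i - p.base i) / p.height ^ lam i, 0) :=
      Prod.ext rfl (zero_div _)
    rw [this, mul_pow]
    refine (hQ _).trans (mul_le_mul_of_nonneg_left (pow_le_pow_left₀ (norm_nonneg _) ?_ 2)
      (sq_nonneg K))
    refine (pi_norm_le_iff_of_nonneg hM).2 fun i => ?_
    have hp := pow_pos p.height_pos (lam i)
    rw [Real.norm_eq_abs, abs_div, abs_of_pos hp, div_le_iff₀ hp, abs_sub_comm]
    exact hb i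

/-- Both points flow up to height `apex p q`, and a horizontal segment of bounded length joins the
two ends. The vertical parts add up to c · log `expDist`. -/
theorem riemannianDistOf_le_log_expDist (hpos : ∀ i, 0 < lam i)
    (g : SmoothRiemannianMetric ((Fin n → ℝ) × ℝ) (Twisted lam))
    (hg : IsLeftInvariantMetric g) {v : Fin n → ℝ} {c K : ℝ} (hc : 0 ≤ c) (hK : 0 ≤ K)
    (hv : formOne g (v, 1) (v, 1) ≤ c ^ 2)
    (hQ : ∀ y, formOne g (y, 0) (y, 0) ≤ K ^ 2 * ‖y‖ ^ 2) (p q : Twisted lam) :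
    riemannianDistOf g p q ≤
      ENNReal.ofReal (c * Real.log (expDist p q) + K * (1 + ‖v‖)) := by
  set t := apex p q with ht
  have hpt := height_le_apex_left p q
  have hqt := height_le_apex_right p q
  have ht0 := apex_pos p q
  have h1 := riemannianDistOf_flowTo_le hpos g hg hc hv p hpt
  have h2 := riemannianDistOf_flowTo_le hpos g hg hc hv q hqt
  -- The 1 pays for the difference of the bases, at most t ^ lam i by the choice of the apex; ‖v‖
  -- pays for the drift of the two flow lines.
  have h3 := riemannianDistOf_le_of_height_eq g hg hK (M := 1 + ‖v‖) (by positivity) hQ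
    (p := flowTo v p t ht0) (q := flowTo v q t ht0) rfl (by
      intro i
      change |(p.base i + v i / lam i * (t ^ lam i - p.height ^ lam i)) -
        (q.base i + v i / lam i * (t ^ lam i - q.height ^ lam i))| ≤ (1 + ‖v‖) * t ^ lam i
      have e : (p.base i + v i / lam i * (t ^ lam i - p.height ^ lam i)) -
        (q.base i + v i / lam i * (t ^ lam i - q.height ^ lam i)) =
        (p.base i - q.base i) + v i / lam i * (q.height ^ lam i - p.height ^ lam i) := by ring
      have hi : (1 : ℝ) ≤ lam i := by exact_mod_cast hpos i
      have a1 : |p.base i - q.base i| ≤ t ^ lam i :=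
        (abs_sub_le_gauge_pow hpos _ _ i).trans
          (pow_le_pow_left₀ (gauge_nonneg _ _) (gauge_le_apex p q) _)
      have a2 : |v i / lam i| ≤ ‖v‖ := by
        rw [abs_div, Nat.abs_cast]
        exact (div_le_self (abs_nonneg _) hi).trans (norm_le_pi_norm v i)
      have a3 : |q.height ^ lam i - p.height ^ lam i| ≤ t ^ lam i := by
        have b1 := pow_le_pow_left₀ p.height_pos.le hpt (lam i)
        have b2 := pow_le_pow_left₀ q.height_pos.le hqt (lam i)
        have b3 := pow_pos p.height_pos (lam i)
        have b4 := pow_pos q.height_pos (lam i)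
        exact abs_sub_le_iff.2 ⟨by linarith, by linarith⟩
      rw [e]
      refine (abs_add_le _ _).trans ?_
      rw [abs_mul, add_mul, one_mul]
      exact add_le_add a1 (mul_le_mul a2 a3 (abs_nonneg _) (norm_nonneg _)))
  rw [riemannianDistOf_comm] at h2
  have e : c * Real.log (expDist p q) + K * (1 + ‖v‖) =
      c * (Real.log t - Real.log p.height) + (K * (1 + ‖v‖) +
        c * (Real.log t - Real.log q.height)) := by
    unfold expDist
    rw [Real.log_div (by positivity) (mul_pos p.height_pos q.height_pos).ne', Real.log_pow,
      Real.log_mul p.height_pos.ne' q.height_pos.ne']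
    push_cast
    ring
  have n1 : 0 ≤ Real.log t - Real.log p.height :=
    sub_nonneg.2 (Real.log_le_log p.height_pos hpt)
  have n2 : 0 ≤ Real.log t - Real.log q.height :=
    sub_nonneg.2 (Real.log_le_log q.height_pos hqt)
  rw [e, ENNReal.ofReal_add (by positivity) (by positivity),
    ENNReal.ofReal_add (by positivity) (by positivity)]
  exact (riemannianDistOf_triangle g p _ q).trans (add_le_add h1
    ((riemannianDistOf_triangle g _ _ q).trans (add_le_add h3 h2)))

/-! ### Lower bound for the distance: maps to hyperbolic planes -/

/-- The left side is the squared derivative of log ((X² + Y²) / a) in direction (U, A), where X and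
Y vary with rates U and A. By Cauchy–Schwarz it is at most U² + A² times 4 / P − 4Y / (P a) + 1 /
a², with P = X² + Y², and the first two terms have nonpositive sum since Y ≥ a. -/
theorem sq_hyperbolic_gradient_le {X Y a U A : ℝ} (ha : 0 < a) (hY : a ≤ Y) :
    ((X ^ 2 + Y ^ 2)⁻¹ * (2 * X * U + 2 * Y * A) - a⁻¹ * A) ^ 2 ≤ (U ^ 2 + A ^ 2) / a ^ 2 := by
  have hP : 0 < X ^ 2 + Y ^ 2 := by nlinarith
  set P := X ^ 2 + Y ^ 2 with hPdef
  have h1 : (P⁻¹ * (2 * X * U + 2 * Y * A) - a⁻¹ * A) ^ 2 ≤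
      (U ^ 2 + A ^ 2) * ((2 * X / P) ^ 2 + (2 * Y / P - 1 / a) ^ 2) := by
    have e : P⁻¹ * (2 * X * U + 2 * Y * A) - a⁻¹ * A =
      U * (2 * X / P) + A * (2 * Y / P - 1 / a) := by ring
    rw [e]
    nlinarith [sq_nonneg (U * (2 * Y / P - 1 / a) - A * (2 * X / P))]
  refine h1.trans ?_
  rw [div_eq_mul_inv (U ^ 2 + A ^ 2)]
  refine mul_le_mul_of_nonneg_left ?_ (by positivity)
  have e : (2 * X / P) ^ 2 + (2 * Y / P - 1 / a) ^ 2 = 4 * (X ^ 2 + Y ^ 2) / P ^ 2 -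
      4 * Y / (P * a) + (a ^ 2)⁻¹ := by
    field_simp
    ring
  have e2 : 4 * (X ^ 2 + Y ^ 2) / P ^ 2 = 4 * a / (P * a) := by
    rw [← hPdef]; field_simp
  rw [e, e2, ← sub_div]
  have : (4 * a - 4 * Y) / (P * a) ≤ 0 :=
    div_nonpos_of_nonpos_of_nonneg (by linarith) (by positivity)
  linarith

/-- The `i`-th coordinate of `ℝⁿ`, corrected so as to be constant along the flow of `(v, 1)`. -/
def shear (v : Fin n → ℝ) (i : Fin n) (l : ℕ) (y : (Fin n → ℝ) × ℝ) : ℝ :=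
  y.1 i - v i / l * y.2 ^ l

/-- The map (x, t) ↦ (m · shear, t ^ l) to the hyperbolic half-plane is l/c-Lipschitz. For
hyperbolic distance ρ between (u, a) and (u₀, a₀), the quotient ((u − u₀)² + (a + a₀)²) / (4 a a₀)
is cosh²(ρ/2) ≤ exp ρ. The proof bounds the gradient of its logarithm directly. -/
theorem hyperbolic_bound (hpos : ∀ i, 0 < lam i)
    (g : SmoothRiemannianMetric ((Fin n → ℝ) × ℝ) (Twisted lam))
    (hg : IsLeftInvariantMetric g) {v : Fin n → ℝ} {c k : ℝ} (hc : 0 < c)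
    (hQ : ∀ y s, formOne g (y, s) (y, s) =
        formOne g (y - s • v, 0) (y - s • v, 0) + c ^ 2 * s ^ 2)
    (hk : ∀ y i, k ^ 2 * y i ^ 2 ≤ formOne g (y, 0) (y, 0)) (p q : Twisted lam)
    (hd : riemannianDistOf g p q ≠ ⊤) (i : Fin n) :
    (k * lam i / c * (shear v i (lam i) (coords p) - shear v i (lam i) (coords q))) ^ 2 +
      (p.height ^ lam i + q.height ^ lam i) ^ 2 ≤
    4 * (p.height ^ lam i * q.height ^ lam i) *
      Real.exp ((riemannianDistOf g p q).toReal / c) ^ lam i := by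
  set l := lam i with hl
  have hl0 : (0 : ℝ) < l := by exact_mod_cast hpos i
  -- This scaling gives the horizontal term k² and the vertical term c² the same factor (l/c)².
  set m := k * l / c with hm
  set u0 := shear v i l (coords q)
  set a0 := q.height ^ l
  have ha0 : 0 < a0 := pow_pos q.height_pos l
  let num : (Fin n → ℝ) × ℝ → ℝ := fun y => (m * (shear v i l y - u0)) ^ 2 + (y.2 ^ l + a0) ^ 2
  let F : (Fin n → ℝ) × ℝ → ℝ := fun y => Real.log (num y) - Real.log (y.2 ^ l)
  have hnum : ∀ y : (Fin n → ℝ) × ℝ, 0 < y.2 → 0 < num y := fun y hy => by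
    have := pow_pos hy l
    positivity
  have hFc : ContDiffOn ℝ 1 F {y | 0 < y.2} := by
    refine ContDiffOn.sub (ContDiffOn.log ?_ fun y hy => (hnum y hy).ne')
      (ContDiffOn.log ?_ fun y hy => (pow_pos hy l).ne')
    · refine ContDiff.contDiffOn ?_
      simp only [num, shear]
      fun_prop
    · fun_prop
  have hF' : ∀ (p : Twisted lam) (w : (Fin n → ℝ) × ℝ), fderiv ℝ F (coords p) w =
      (num (coords p))⁻¹ * (2 * (m * (shear v i l (coords p) - u0)) *
        (m * (w.1 i - v i * p.height ^ (l - 1) * w.2)) +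
        2 * (p.height ^ l + a0) * (l * p.height ^ (l - 1) * w.2)) -
      (p.height ^ l)⁻¹ * (l * p.height ^ (l - 1) * w.2) := by
    intro p w
    have d1 : HasFDerivAt (fun y : (Fin n → ℝ) × ℝ => y.1 i)
        ((ContinuousLinearMap.proj i : (Fin n → ℝ) →L[ℝ] ℝ).comp
          (ContinuousLinearMap.fst ℝ (Fin n → ℝ) ℝ)) (coords p) :=
      ((ContinuousLinearMap.proj i : (Fin n → ℝ) →L[ℝ] ℝ).comp
          (ContinuousLinearMap.fst ℝ (Fin n → ℝ) ℝ)).hasFDerivAt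
    have d2 : HasFDerivAt (fun y : (Fin n → ℝ) × ℝ => y.2 ^ l) _ (coords p) :=
      (ContinuousLinearMap.snd ℝ (Fin n → ℝ) ℝ).hasFDerivAt.pow l
    have d3 : HasFDerivAt (shear v i l) _ (coords p) := d1.sub (d2.const_mul (v i / l))
    have d4 := ((d3.sub_const u0).const_mul m).pow 2
    have d5 := (d2.add_const a0).pow 2
    have d6 : HasFDerivAt F _ (coords p) := ((d4.add d5).log (hnum _ p.height_pos).ne').sub
      (d2.log (pow_pos p.height_pos l).ne')
    rw [d6.fderiv]
    have e : (coords p).2 = p.height := rfl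
    simp [e, num]
    field_simp
  have hb : ∀ (p : Twisted lam) (w : (Fin n → ℝ) × ℝ),
      (fderiv ℝ F (coords p) w) ^ 2 ≤ (l / c) ^ 2 * g.inner p w w := by
    intro p w
    have ht := p.height_pos
    have hpow : p.height ^ l = p.height ^ (l - 1) * p.height := by
      rw [← pow_succ, Nat.sub_add_cancel (hpos i)]
    rw [hF', inner_eq_formOne g hg]
    refine (sq_hyperbolic_gradient_le (pow_pos ht l)
      (le_add_of_nonneg_right ha0.le : p.height ^ l ≤ p.height ^ l + a0)).trans ?_
    have h1 := hk ((pullOne p w).1 - (pullOne p w).2 • v) i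
    have h2 := hQ (pullOne p w).1 (pullOne p w).2
    rw [Prod.mk.eta] at h2
    rw [h2]
    have h3 : ((pullOne p w).1 - (pullOne p w).2 • v) i =
        (w.1 i - v i * p.height ^ (l - 1) * w.2) / p.height ^ l := by
      simp only [pullOne, Pi.sub_apply, Pi.smul_apply, smul_eq_mul, ← hl]
      rw [hpow]
      field_simp
    have h4 : (pullOne p w).2 = w.2 / p.height := rfl
    rw [h3] at h1
    refine le_trans (le_of_eq ?_) (mul_le_mul_of_nonneg_left (add_le_add_left h1 _) (sq_nonneg _))
    rw [h4, hm, hpow]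
    field_simp
  have key := enorm_sub_le_riemannianDistOf g hFc (div_pos hl0 hc) hb q p
  rw [riemannianDistOf_comm g q p] at key
  have key2 : F (coords p) - F (coords q) ≤ l / c * (riemannianDistOf g p q).toReal := by
    have := ENNReal.toReal_mono (ENNReal.mul_ne_top ENNReal.ofReal_ne_top hd) key
    rw [ENNReal.toReal_mul, ENNReal.toReal_ofReal (div_pos hl0 hc).le, toReal_enorm] at this
    exact (le_abs_self _).trans this
  have hFq : F (coords q) = Real.log (4 * a0) := by
    have e : num (coords q) = 4 * a0 * a0 := by
      change (m * (u0 - u0)) ^ 2 + (a0 + a0) ^ 2 = _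
      ring
    change Real.log (num (coords q)) - Real.log a0 = _
    rw [e, Real.log_mul (by positivity) (by positivity)]
    ring
  have hFp : F (coords p) = Real.log (num (coords p)) - Real.log (p.height ^ l) := rfl
  have hnp := hnum (coords p) p.height_pos
  have hap := pow_pos p.height_pos l
  rw [hFq, hFp, sub_sub, ← Real.log_mul (by positivity) (by positivity),
    ← Real.log_div (by positivity) (by positivity), Real.log_le_iff_le_exp (by positivity),
    div_le_iff₀ (by positivity)] at key2
  rw [← Real.exp_nat_mul]
  refine key2.trans (le_of_eq ?_)
  rw [show (l : ℝ) * ((riemannianDistOf g p q).toReal / c) =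
    l / c * (riemannianDistOf g p q).toReal by ring]
  ring

theorem expDist_le_mul_exp [Nonempty (Fin n)] (hpos : ∀ i, 0 < lam i)
    (g : SmoothRiemannianMetric ((Fin n → ℝ) × ℝ) (Twisted lam))
    (hg : IsLeftInvariantMetric g) {v : Fin n → ℝ} {c k : ℝ} (hc : 0 < c) (hk0 : 0 < k)
    (hQ : ∀ y s, formOne g (y, s) (y, s) =
        formOne g (y - s • v, 0) (y - s • v, 0) + c ^ 2 * s ^ 2)
    (hk : ∀ y i, k ^ 2 * y i ^ 2 ≤ formOne g (y, 0) (y, 0)) (p q : Twisted lam)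
    (hd : riemannianDistOf g p q ≠ ⊤) :
    expDist p q ≤ (2 * (1 + c / k + ‖v‖)) ^ 2 *
      Real.exp ((riemannianDistOf g p q).toReal / c) := by
  have hp := p.height_pos
  have hq := q.height_pos
  set e := Real.exp ((riemannianDistOf g p q).toReal / c) with he
  have he0 : 0 < e := Real.exp_pos _
  -- In terms of Z the right side of `hyperbolic_bound` is (2 Z ^ lam i)², so it suffices to bound
  -- the apex by a multiple of Z.
  set Z := √(p.height * q.height * e) with hZ
  have hZ0 : 0 < Z := Real.sqrt_pos.2 (by positivity)
  have hZ2 : Z ^ 2 = p.height * q.height * e := Real.sq_sqrt (by positivity)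
  -- The summands account for the heights, the sheared coordinate, and undoing the shear.
  set M := 2 * (1 + c / k + ‖v‖) with hM
  have hck : 0 < c / k := div_pos hc hk0
  have hv := norm_nonneg v
  have hM2 : 2 ≤ M := by linarith
  have bound : ∀ i, (k * lam i / c *
      (shear v i (lam i) (coords p) - shear v i (lam i) (coords q))) ^ 2 +
      (p.height ^ lam i + q.height ^ lam i) ^ 2 ≤ (2 * Z ^ lam i) ^ 2 := by
    intro i
    refine (hyperbolic_bound hpos g hg hc hQ hk p q hd i).trans (le_of_eq ?_)
    rw [mul_pow, ← pow_mul, mul_comm (lam i) 2, pow_mul, hZ2, mul_pow, mul_pow]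
    ring
  have two_le : ∀ i, (2 : ℝ) ≤ 2 ^ lam i := fun i => by
    simpa using pow_le_pow_right₀ (one_le_two (α := ℝ)) (hpos i)
  have M_le : ∀ i, M ≤ M ^ lam i := fun i => by
    simpa using pow_le_pow_right₀ (by linarith : (1 : ℝ) ≤ M) (hpos i)
  have heights : ∀ i, p.height ^ lam i + q.height ^ lam i ≤ 2 * Z ^ lam i := fun i =>
    (abs_le_of_sq_le_sq' (by nlinarith [bound i, sq_nonneg (k * lam i / c *
      (shear v i (lam i) (coords p) - shear v i (lam i) (coords q)))]) (by positivity)).2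
  have hapex : apex p q ≤ M * Z := by
    obtain ⟨i⟩ := ‹Nonempty (Fin n)›
    have h2Z : (2 * Z ^ lam i) ≤ (M * Z) ^ lam i := by
      rw [mul_pow]
      exact mul_le_mul_of_nonneg_right (hM2.trans (M_le i)) (by positivity)
    have h1 := heights i
    have hpl := pow_pos hp (lam i)
    have hql := pow_pos hq (lam i)
    refine apex_le_iff.2 ⟨?_, ?_, (gauge_le_iff hpos (by positivity)).2 fun j => ?_⟩
    · exact le_of_pow_le_pow_left₀ (hpos i).ne' (by positivity) (by linarith)
    · exact le_of_pow_le_pow_left₀ (hpos i).ne' (by positivity) (by linarith)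
    · have hj : (1 : ℝ) ≤ lam j := by exact_mod_cast hpos j
      have hZj := pow_pos hZ0 (lam j)
      set S := shear v j (lam j) (coords p) - shear v j (lam j) (coords q) with hS
      have b1 : |k * lam j / c * S| ≤ 2 * Z ^ lam j :=
        abs_le_of_sq_le_sq (by nlinarith [bound j, sq_nonneg (p.height ^ lam j + q.height ^ lam j)])
          (by positivity)
      have b2 : |S| ≤ c / k * (2 * Z ^ lam j) := by
        rw [abs_mul, abs_of_pos (by positivity)] at b1
        have : k / c * |S| ≤ k * lam j / c * |S| := by
          refine mul_le_mul_of_nonneg_right ?_ (abs_nonneg _)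
          rw [mul_div_right_comm]
          exact le_mul_of_one_le_right (by positivity) hj
        calc |S| = c / k * (k / c * |S|) := by field_simp
          _ ≤ _ := mul_le_mul_of_nonneg_left (this.trans b1) hck.le
      have b3 : |v j / lam j * (p.height ^ lam j - q.height ^ lam j)| ≤ ‖v‖ * (2 * Z ^ lam j) := by
        rw [abs_mul, abs_div, Nat.abs_cast]
        refine mul_le_mul ((div_le_self (abs_nonneg _) hj).trans (norm_le_pi_norm v j)) ?_
          (abs_nonneg _) hv
        have := heights j
        have := pow_pos hp (lam j)
        have := pow_pos hq (lam j)
        exact abs_sub_le_iff.2 ⟨by linarith, by linarith⟩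
      have e1 : p.base j - q.base j = S + v j / lam j * (p.height ^ lam j - q.height ^ lam j) := by
        have e2 : ∀ r : Twisted lam, shear v j (lam j) (coords r) =
          r.base j - v j / lam j * r.height ^ lam j := fun r => rfl
        rw [hS, e2, e2]; ring
      rw [e1]
      calc _ ≤ c / k * (2 * Z ^ lam j) + ‖v‖ * (2 * Z ^ lam j) :=
            (abs_add_le _ _).trans (add_le_add b2 b3)
        _ ≤ M * Z ^ lam j := by rw [hM]; nlinarith
        _ ≤ (M * Z) ^ lam j := by
            rw [mul_pow]
            exact mul_le_mul_of_nonneg_right (M_le j) hZj.le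
  unfold expDist
  rw [div_le_iff₀ (by positivity)]
  calc apex p q ^ 2 ≤ (M * Z) ^ 2 := pow_le_pow_left₀ (apex_pos p q).le hapex 2
    _ = _ := by rw [mul_pow, hZ2]; ring

/-- The distance of a left-invariant metric is proportional, up to an additive error, to the
logarithm of `expDist`. -/
theorem exists_expDist_bounds [Nonempty (Fin n)] (hpos : ∀ i, 0 < lam i)
    (g : SmoothRiemannianMetric ((Fin n → ℝ) × ℝ) (Twisted lam))
    (hg : IsLeftInvariantMetric g) : ∃ c K : ℝ, 0 < c ∧ 1 ≤ K ∧ ∀ p q : Twisted lam,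
      riemannianDistOf g p q ≠ ⊤ ∧
      expDist p q ≤ K * Real.exp ((riemannianDistOf g p q).toReal / c) ∧
      Real.exp ((riemannianDistOf g p q).toReal / c) ≤ K * expDist p q := by
  obtain ⟨v, c, k, K, hc, hk0, hK, hQ, hk, hK'⟩ := exists_formOne_bounds g
  have hvc : formOne g (v, 1) (v, 1) ≤ c ^ 2 := by
    refine le_of_eq ((hQ v 1).trans ?_)
    have : ((v - (1 : ℝ) • v, 0) : (Fin n → ℝ) × ℝ) = 0 := by simp
    rw [this]
    simp
  refine ⟨c, max ((2 * (1 + c / k + ‖v‖)) ^ 2) (Real.exp (K * (1 + ‖v‖) / c)), hc,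
    le_max_of_le_right (Real.one_le_exp (by positivity)), fun p q => ?_⟩
  have h := riemannianDistOf_le_log_expDist hpos g hg hc.le hK hvc hK' p q
  have hd : riemannianDistOf g p q ≠ ⊤ := (h.trans_lt ENNReal.ofReal_lt_top).ne
  refine ⟨hd, (expDist_le_mul_exp hpos g hg hc hk0 hQ hk p q hd).trans
    (mul_le_mul_of_nonneg_right (le_max_left _ _) (Real.exp_pos _).le), ?_⟩
  have hl := Real.log_nonneg (one_le_expDist p q)
  have h2 := ENNReal.toReal_mono ENNReal.ofReal_ne_top h
  rw [ENNReal.toReal_ofReal (by positivity)] at h2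
  have hN := expDist_pos p q
  calc _ ≤ Real.exp (K * (1 + ‖v‖) / c) * expDist p q := by
        conv_rhs => rw [← Real.exp_log hN]
        rw [← Real.exp_add]
        refine Real.exp_le_exp.2 ?_
        rw [div_le_iff₀ hc]
        refine h2.trans (le_of_eq ?_)
        field_simp
        ring
    _ ≤ _ := mul_le_mul_of_nonneg_right (le_max_right _ _) hN.le

/-! ### Coarse isometries along vertical rays -/

/-- `f` preserves `expDist` up to the factor `K`. -/
def CoarselyPreserves (K : ℝ) (f : Twisted lam → Twisted lam) : Prop :=
  ∀ p q, expDist (f p) (f q) ≤ K * expDist p q ∧ expDist p q ≤ K * expDist (f p) (f q)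

@[simp] theorem base_mk (x : Fin n → ℝ) (t : ℝ) (ht : 0 < t) :
    (mk x t ht : Twisted lam).base = x := rfl

@[simp] theorem height_mk (x : Fin n → ℝ) (t : ℝ) (ht : 0 < t) :
    (mk x t ht : Twisted lam).height = t := rfl

theorem isBounded_gauge_le (hpos : ∀ i, 0 < lam i) (z : Fin n → ℝ) (B : ℝ) :
    Bornology.IsBounded {y | gauge lam y z ≤ B} := by
  rcases lt_or_ge B 0 with hB | hB
  · convert Bornology.isBounded_empty (α := Fin n → ℝ)
    exact eq_empty_iff_forall_notMem.2 fun y hy => absurd (gauge_nonneg y z) (by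
      have : gauge lam y z ≤ B := hy
      linarith)
  rw [← Bornology.forall_isBounded_image_eval_iff]
  intro i
  refine (Metric.isBounded_closedBall (x := z i) (r := B ^ lam i)).subset ?_
  rintro _ ⟨y, hy, rfl⟩
  exact (gauge_le_iff hpos hB).1 hy i

theorem expDist_mk_of_le {p : Twisted lam} {x : Fin n → ℝ} {s : ℝ} (hs : 0 < s)
    (h1 : p.height ≤ s) (h2 : gauge lam p.base x ≤ s) :
    expDist p (mk x s hs) = s / p.height := by
  have : apex p (mk x s hs) = s :=
    le_antisymm (apex_le_iff.2 ⟨h1, le_rfl, h2⟩) (height_le_apex_right p (mk x s hs))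
  unfold expDist
  rw [this, height_mk]
  have := p.height_pos
  field_simp

theorem expDist_vertical (hpos : ∀ i, 0 < lam i) (x : Fin n → ℝ) {s t : ℝ} (hs : 0 < s)
    (ht : 0 < t) (hst : s ≤ t) : expDist (mk x s hs : Twisted lam) (mk x t ht) = t / s :=
  expDist_mk_of_le ht hst (by rw [base_mk, (gauge_eq_zero_iff hpos).2 rfl]; exact ht.le)

section vertical

variable {K : ℝ} {f : Twisted lam → Twisted lam}

theorem CoarselyPreserves.apex_sq_le (hf : CoarselyPreserves K f) (p q : Twisted lam) :
    apex (f p) (f q) ^ 2 ≤ K * expDist p q * ((f p).height * (f q).height) := by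
  rw [apex_sq]
  exact mul_le_mul_of_nonneg_right (hf p q).1 (mul_pos (f p).height_pos (f q).height_pos).le

theorem CoarselyPreserves.le_apex_sq (hf : CoarselyPreserves K f) (p q : Twisted lam) :
    expDist p q * ((f p).height * (f q).height) ≤ K * apex (f p) (f q) ^ 2 := by
  rw [apex_sq, ← mul_assoc K]
  exact mul_le_mul_of_nonneg_right (hf p q).2 (mul_pos (f p).height_pos (f q).height_pos).le

/-- Heights grow at most linearly, and decay at most like the inverse, along images of vertical
rays. -/
theorem CoarselyPreserves.height_mul_le (hpos : ∀ i, 0 < lam i) (hf : CoarselyPreserves K f)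
    (x : Fin n → ℝ) {s t : ℝ} (hs : 0 < s) (ht : 0 < t) (hst : s ≤ t) :
    (f (mk x s hs)).height * s ≤ K * ((f (mk x t ht)).height * t) ∧
    (f (mk x t ht)).height * s ≤ K * ((f (mk x s hs)).height * t) := by
  -- The apex of the images dominates both image heights, so the square of each is at most K (t / s)
  -- times their product; one factor cancels.
  have h := hf.apex_sq_le (mk x s hs) (mk x t ht)
  rw [expDist_vertical hpos x hs ht hst] at h
  have p1 := (f (mk x s hs)).height_pos
  have p2 := (f (mk x t ht)).height_pos
  have a1 := pow_le_pow_left₀ p1.le (height_le_apex_left (f (mk x s hs)) (f (mk x t ht))) 2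
  have a2 := pow_le_pow_left₀ p2.le (height_le_apex_right (f (mk x s hs)) (f (mk x t ht))) 2
  set a := (f (mk x s hs)).height
  set b := (f (mk x t ht)).height
  have e : K * (t / s) * (a * b) * s = K * t * (a * b) := by field_simp
  constructor
  · have := mul_le_mul_of_nonneg_right (a1.trans h) hs.le
    rw [e] at this
    exact le_of_mul_le_mul_left (by linarith) p1
  · have := mul_le_mul_of_nonneg_right (a2.trans h) hs.le
    rw [e] at this
    exact le_of_mul_le_mul_left (by linarith) p2

/-- The image of a vertical ray rises and then falls. -/
theorem CoarselyPreserves.rises_or_falls (hpos : ∀ i, 0 < lam i) (hK : 0 < K)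
    (hf : CoarselyPreserves K f) (x : Fin n → ℝ) {u v w : ℝ} (hu : 0 < u) (hv : 0 < v)
    (hw : 0 < w) (huv : u ≤ v) (hvw : v ≤ w) :
    (f (mk x u hu)).height * v ≤ 4 * K ^ 4 * ((f (mk x v hv)).height * u) ∨
    (f (mk x w hw)).height * w ≤ 4 * K ^ 4 * ((f (mk x v hv)).height * v) := by
  have h1 := hf.apex_sq_le (mk x u hu) (mk x v hv)
  have h2 := hf.apex_sq_le (mk x v hv) (mk x w hw)
  have h3 := hf.le_apex_sq (mk x u hu) (mk x w hw)
  have h4 := hf.le_apex_sq (mk x u hu) (mk x v hv)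
  have h5 := hf.le_apex_sq (mk x v hv) (mk x w hw)
  rw [expDist_vertical hpos x hu hv huv] at h1 h4
  rw [expDist_vertical hpos x hv hw hvw] at h2 h5
  rw [expDist_vertical hpos x hu hw (huv.trans hvw)] at h3
  have tri := apex_triangle hpos (f (mk x u hu)) (f (mk x v hv)) (f (mk x w hw))
  have A := (f (mk x u hu)).height_pos
  have B := (f (mk x v hv)).height_pos
  have C := (f (mk x w hw)).height_pos
  have U := apex_pos (f (mk x u hu)) (f (mk x v hv))
  have V := apex_pos (f (mk x v hv)) (f (mk x w hw))
  have W := apex_pos (f (mk x u hu)) (f (mk x w hw))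
  set a := (f (mk x u hu)).height
  set b := (f (mk x v hv)).height
  set c := (f (mk x w hw)).height
  set U' := apex (f (mk x u hu)) (f (mk x v hv))
  set V' := apex (f (mk x v hv)) (f (mk x w hw))
  set W' := apex (f (mk x u hu)) (f (mk x w hw))
  -- On a vertical ray `expDist` is multiplicative. As W' ≤ 2 max(U', V'), the larger of U', V'
  -- cancels and the smaller is comparable to the middle height b. If it is U', the image rises from
  -- u to v; if it is V', the image falls from v to w.
  have prod : U' ^ 2 * V' ^ 2 ≤ K ^ 3 * b ^ 2 * W' ^ 2 := by
    calc U' ^ 2 * V' ^ 2 ≤ (K * (v / u) * (a * b)) * (K * (w / v) * (b * c)) :=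
          mul_le_mul h1 h2 (by positivity) (by positivity)
      _ = K ^ 2 * b ^ 2 * (w / u * (a * c)) := by field_simp
      _ ≤ K ^ 2 * b ^ 2 * (K * W' ^ 2) := mul_le_mul_of_nonneg_left h3 (by positivity)
      _ = _ := by ring
  rcases le_total U' V' with h | h
  · left
    rw [max_eq_right h] at tri
    have t2 := pow_le_pow_left₀ W.le tri 2
    have : U' ^ 2 ≤ 4 * K ^ 3 * b ^ 2 := by
      refine le_of_mul_le_mul_right (a := V' ^ 2) ?_ (by positivity)
      refine prod.trans ((mul_le_mul_of_nonneg_left t2 (by positivity)).trans (le_of_eq (by ring)))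
    have e := h4.trans (mul_le_mul_of_nonneg_left this hK.le)
    refine le_of_mul_le_mul_right (a := b / u) ?_ (by positivity)
    calc a * v * (b / u) = v / u * (a * b) := by ring
      _ ≤ _ := e
      _ = _ := by field_simp
  · right
    rw [max_eq_left h] at tri
    have t2 := pow_le_pow_left₀ W.le tri 2
    have : V' ^ 2 ≤ 4 * K ^ 3 * b ^ 2 := by
      refine le_of_mul_le_mul_left (a := U' ^ 2) ?_ (by positivity)
      refine prod.trans ((mul_le_mul_of_nonneg_left t2 (by positivity)).trans (le_of_eq (by ring)))
    have e := h5.trans (mul_le_mul_of_nonneg_left this hK.le)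
    refine le_of_mul_le_mul_right (a := b / v) ?_ (by positivity)
    calc c * w * (b / v) = w / v * (b * c) := by ring
      _ ≤ _ := e
      _ = _ := by field_simp

end vertical

/-! ### Falling rays and inversions -/

/-- `max (height q) (gauge (base q) ξ)`: the `apex` of `q` and the boundary point `ξ`. -/
def apexAt (ξ : Fin n → ℝ) (q : Twisted lam) : ℝ := max q.height (gauge lam q.base ξ)

theorem apexAt_pos (ξ : Fin n → ℝ) (q : Twisted lam) : 0 < apexAt ξ q :=
  q.height_pos.trans_le (le_max_left _ _)

/-- The boundary point ξ plays the middle point, of height 0, in the triangle inequality. -/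
theorem apex_le_apexAt (hpos : ∀ i, 0 < lam i) (ξ : Fin n → ℝ) (p q : Twisted lam) :
    apex p q ≤ 2 * max (apexAt ξ p) (apexAt ξ q) := by
  have h1 := le_max_left (apexAt ξ p) (apexAt ξ q)
  have h2 := le_max_right (apexAt ξ p) (apexAt ξ q)
  have h3 := apexAt_pos ξ p
  refine apex_le_iff.2 ⟨?_, ?_, ?_⟩
  · have : p.height ≤ apexAt ξ p := le_max_left _ _
    linarith
  · have : q.height ≤ apexAt ξ q := le_max_left _ _
    linarith [apexAt_pos ξ q]
  · refine (gauge_triangle hpos _ ξ _).trans ?_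
    rw [gauge_comm ξ]
    have : max (gauge lam p.base ξ) (gauge lam q.base ξ) ≤ max (apexAt ξ p) (apexAt ξ q) :=
      max_le_max (le_max_right _ _) (le_max_right _ _)
    linarith

theorem tendsto_gauge {ι : Type*} {l : Filter ι} {x y : ι → Fin n → ℝ} {x' y' : Fin n → ℝ}
    (hx : Tendsto x l (𝓝 x')) (hy : Tendsto y l (𝓝 y')) :
    Tendsto (fun k => gauge lam (x k) (y k)) l (𝓝 (gauge lam x' y')) := by
  have h := (continuous_gauge (lam := lam)).tendsto (x', y')
  have h' := Tendsto.comp h (hx.prodMk_nhds hy)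
  exact h'

theorem tendsto_apex {ι : Type*} {l : Filter ι} {p q : ι → Twisted lam} {x y : Fin n → ℝ} {s t : ℝ}
    (h1 : Tendsto (fun k => (p k).base) l (𝓝 x)) (h2 : Tendsto (fun k => (p k).height) l (𝓝 s))
    (h3 : Tendsto (fun k => (q k).base) l (𝓝 y)) (h4 : Tendsto (fun k => (q k).height) l (𝓝 t)) :
    Tendsto (fun k => apex (p k) (q k)) l (𝓝 (max (max s t) (gauge lam x y))) :=
  (h2.max h4).max (tendsto_gauge h1 h3)

theorem tendsto_apexAt {ι : Type*} {l : Filter ι} {p : ι → Twisted lam} {x : Fin n → ℝ} {s : ℝ}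
    (ξ : Fin n → ℝ)
    (h1 : Tendsto (fun k => (p k).base) l (𝓝 x)) (h2 : Tendsto (fun k => (p k).height) l (𝓝 s)) :
    Tendsto (fun k => apexAt ξ (p k)) l (𝓝 (max s (gauge lam x ξ))) :=
  h2.max (tendsto_gauge h1 tendsto_const_nhds)

/-- If the image of a vertical ray falls to a point `ξ` of the boundary, then the map behaves like
an inversion centred at `ξ`. -/
theorem CoarselyPreserves.exists_inversion (hpos : ∀ i, 0 < lam i) {K : ℝ} (hK : 1 ≤ K)
    {f : Twisted lam → Twisted lam} (hf : CoarselyPreserves K f) (x : Fin n → ℝ) {v c : ℝ}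
    (hv : 0 < v)
    (hfall : ∀ w (hw : v ≤ w), (f (mk x w (hv.trans_le hw))).height * w ≤ c) :
    ∃ (ξ : Fin n → ℝ) (C : ℝ), 1 ≤ C ∧
      (∀ p, (f p).height ≤ C * (apexAt ξ (f p) ^ 2 * p.height)) ∧
      (∀ p q, apex (f p) (f q) ≤ C * (apexAt ξ (f p) * apexAt ξ (f q) * apex p q)) ∧
      ∀ p q, apexAt ξ (f p) * apexAt ξ (f q) * apex p q ≤ C * apex (f p) (f q) := by
  have hK0 : 0 < K := by linarith
  let s : ℕ → ℝ := fun k => v + k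
  have hvs : ∀ k, v ≤ s k := fun k => le_add_of_nonneg_right (Nat.cast_nonneg k)
  have hs : ∀ k, 0 < s k := fun k => hv.trans_le (hvs k)
  let P : ℕ → Twisted lam := fun k => f (mk x (s k) (hs k))
  have hP0 : ∀ k, 0 < (P k).height := fun k => (P k).height_pos
  set h0 := (f (mk x v hv)).height with hh0
  have h0pos : 0 < h0 := (f (mk x v hv)).height_pos
  set d := h0 * v / K with hd
  have hd0 : 0 < d := by positivity
  have hup : ∀ k, (P k).height * s k ≤ c := fun k => hfall _ (hvs k)
  have hlow : ∀ k, d ≤ (P k).height * s k := fun k => by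
    rw [hd, div_le_iff₀ hK0, mul_comm _ K]
    exact (hf.height_mul_le hpos x hv (hs k) (hvs k)).1
  have hc0 : 0 < c := hd0.trans_le ((hlow 0).trans (hup 0))
  have hs_atTop : Tendsto s atTop atTop :=
    tendsto_atTop_add_const_left _ _ tendsto_natCast_atTop_atTop
  -- the bases stay bounded
  have hbase : ∀ k, gauge lam (P k).base (f (mk x v hv)).base ≤ √(K * h0 * c / v) := by
    intro k
    refine Real.le_sqrt_of_sq_le ?_
    rw [gauge_comm]
    refine (pow_le_pow_left₀ (gauge_nonneg _ _) (gauge_le_apex _ _) 2).trans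
      ((hf.apex_sq_le (mk x v hv) (mk x (s k) (hs k))).trans ?_)
    rw [expDist_vertical hpos x hv (hs k) (hvs k)]
    calc K * (s k / v) * (h0 * (P k).height) = K * h0 / v * ((P k).height * s k) := by ring
      _ ≤ K * h0 / v * c := mul_le_mul_of_nonneg_left (hup k) (by positivity)
      _ = _ := by ring
  obtain ⟨ξ, -, φ, hφ, hξ⟩ := tendsto_subseq_of_bounded
    (isBounded_gauge_le hpos (f (mk x v hv)).base (√(K * h0 * c / v))) hbase
  have hheight : Tendsto (fun k => (P (φ k)).height) atTop (𝓝 0) := by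
    have h1 : Tendsto (fun k => c / s (φ k)) atTop (𝓝 0) :=
      tendsto_const_nhds.div_atTop (hs_atTop.comp hφ.tendsto_atTop)
    exact squeeze_zero (fun k => (hP0 _).le) (fun k => (le_div_iff₀ (hs _)).2 (hup _)) h1
  -- The points P (φ k) converge to ξ at height 0. Comparing `f p` with them therefore determines (f
  -- p).height / p.height, up to constants, as the square of `apexAt ξ (f p)`.
  have hlim : ∀ p, Tendsto (fun k => apex (f p) (P (φ k)) ^ 2) atTop
      (𝓝 (apexAt ξ (f p) ^ 2)) := by
    intro p
    have := tendsto_apex (lam := lam) (p := fun _ : ℕ => f p) tendsto_const_nhds tendsto_const_nhds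
      hξ hheight
    rw [max_eq_left (f p).height_pos.le] at this
    exact this.pow 2
  have hev : ∀ p : Twisted lam, ∀ᶠ k in atTop,
      expDist p (mk x (s (φ k)) (hs _)) = s (φ k) / p.height := by
    intro p
    have h := (hs_atTop.comp hφ.tendsto_atTop).eventually_ge_atTop
      (max p.height (gauge lam p.base x))
    filter_upwards [h] with k hk
    exact expDist_mk_of_le (hs _) ((le_max_left _ _).trans hk) ((le_max_right _ _).trans hk)
  have upper : ∀ p, apexAt ξ (f p) ^ 2 ≤ K * c * ((f p).height / p.height) := by
    intro p
    refine le_of_tendsto (hlim p) ?_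
    filter_upwards [hev p] with k hk
    have h := hf.apex_sq_le p (mk x (s (φ k)) (hs _))
    rw [hk] at h
    have := p.height_pos
    have := (f p).height_pos
    calc _ ≤ _ := h
      _ = K * ((f p).height / p.height) * ((P (φ k)).height * s (φ k)) := by ring
      _ ≤ K * ((f p).height / p.height) * c :=
        mul_le_mul_of_nonneg_left (hup _) (by positivity)
      _ = _ := by ring
  have lower : ∀ p, (f p).height / p.height ≤ K / d * apexAt ξ (f p) ^ 2 := by
    intro p
    refine ge_of_tendsto ((hlim p).const_mul _) ?_
    filter_upwards [hev p] with k hk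
    have h := hf.le_apex_sq p (mk x (s (φ k)) (hs _))
    rw [hk] at h
    have := p.height_pos
    have := (f p).height_pos
    rw [div_mul_eq_mul_div, le_div_iff₀ hd0]
    calc _ ≤ (f p).height / p.height * ((P (φ k)).height * s (φ k)) :=
          mul_le_mul_of_nonneg_left (hlow _) (by positivity)
      _ = s (φ k) / p.height * ((f p).height * (P (φ k)).height) := by ring
      _ ≤ _ := h
  -- one constant for everything
  set A := max (K * c) (K / d) with hA
  have hA0 : 0 < A := lt_max_of_lt_left (by positivity)
  -- Height quotients can now be traded for `apexAt` factors, which yields the inversion law |f x −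
  -- f y| ≈ |f x − ξ| |f y − ξ| |x − y| after taking roots.
  have key : ∀ p q, expDist p q * ((f p).height * (f q).height) =
      apex p q ^ 2 * ((f p).height / p.height) * ((f q).height / q.height) := by
    intro p q
    unfold expDist
    have := p.height_pos
    have := q.height_pos
    field_simp
  have hp0 : ∀ p, 0 < (f p).height / p.height := fun p => div_pos (f p).height_pos p.height_pos
  have lowerA : ∀ p, (f p).height / p.height ≤ A * apexAt ξ (f p) ^ 2 := fun p =>
    (lower p).trans (mul_le_mul_of_nonneg_right (le_max_right _ _) (sq_nonneg _))
  have upperA : ∀ p, apexAt ξ (f p) ^ 2 ≤ A * ((f p).height / p.height) := fun p =>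
    (upper p).trans (mul_le_mul_of_nonneg_right (le_max_left _ _) (hp0 p).le)
  have hKK : K ≤ K ^ 2 := le_self_pow₀ hK two_ne_zero
  refine ⟨ξ, max 1 (K * A + A), le_max_left _ _, fun p => ?_, fun p q => ?_, fun p q => ?_⟩
  · have h := lowerA p
    rw [div_le_iff₀ p.height_pos, mul_assoc] at h
    refine h.trans (mul_le_mul_of_nonneg_right (le_max_of_le_right (by nlinarith)) ?_)
    have := p.height_pos
    positivity
  · have h1 := apexAt_pos ξ (f p)
    have h2 := apexAt_pos ξ (f q)
    have h3 := apex_pos p q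
    have : apex (f p) (f q) ≤ K * A * (apexAt ξ (f p) * apexAt ξ (f q) * apex p q) := by
      refine le_of_sq_le_sq ?_ (by positivity)
      refine (hf.apex_sq_le p q).trans ?_
      rw [mul_assoc, key]
      calc K * (apex p q ^ 2 * ((f p).height / p.height) * ((f q).height / q.height))
          ≤ K ^ 2 * (apex p q ^ 2 * (A * apexAt ξ (f p) ^ 2) * (A * apexAt ξ (f q) ^ 2)) := by
            have i1 := lowerA p
            have i2 := lowerA q
            have i3 := hp0 p
            have i4 := hp0 q
            gcongr
        _ = _ := by ring
    exact this.trans (mul_le_mul_of_nonneg_right (le_max_of_le_right (by linarith)) (by positivity))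
  · have h1 := apexAt_pos ξ (f p)
    have h2 := apexAt_pos ξ (f q)
    have h3 := apex_pos p q
    have h4 := apex_pos (f p) (f q)
    have : apexAt ξ (f p) * apexAt ξ (f q) * apex p q ≤ K * A * apex (f p) (f q) := by
      refine le_of_sq_le_sq ?_ (by positivity)
      calc (apexAt ξ (f p) * apexAt ξ (f q) * apex p q) ^ 2
          = apex p q ^ 2 * apexAt ξ (f p) ^ 2 * apexAt ξ (f q) ^ 2 := by ring
        _ ≤ apex p q ^ 2 * (A * ((f p).height / p.height)) * (A * ((f q).height / q.height)) := by
            have i1 := upperA p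
            have i2 := upperA q
            have i3 := hp0 p
            gcongr
        _ = A ^ 2 * (expDist p q * ((f p).height * (f q).height)) := by rw [key]; ring
        _ ≤ A ^ 2 * (K * apex (f p) (f q) ^ 2) :=
            mul_le_mul_of_nonneg_left (hf.le_apex_sq p q) (by positivity)
        _ ≤ A ^ 2 * (K ^ 2 * apex (f p) (f q) ^ 2) := by gcongr
        _ = _ := by ring
    exact this.trans (mul_le_mul_of_nonneg_right (le_max_of_le_right (by linarith)) h4.le)

/-! ### Excluding inversions along the direction of smallest weight -/

/-- There is no inversion-like map of a whole line in the direction of smallest weight. -/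
theorem not_exists_inverted_line (hpos : ∀ i, 0 < lam i) {a : Fin n}
    (ha : ∀ i, i ≠ a → lam a < lam i) (f : ℝ → Fin n → ℝ) (ξ : Fin n → ℝ) {C : ℝ} (hC : 1 ≤ C)
    (hne : ∀ u, f u ≠ ξ)
    (hup : ∀ u w, gauge lam (f u) (f w) ≤
      C * (gauge lam (f u) ξ * gauge lam (f w) ξ * |u - w| ^ ((lam a : ℝ)⁻¹)))
    (hlow : ∀ u w, gauge lam (f u) ξ * gauge lam (f w) ξ * |u - w| ^ ((lam a : ℝ)⁻¹) ≤
      C * gauge lam (f u) (f w)) : False := by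
  have hC0 : 0 < C := by linarith
  set E : ℝ → ℝ := fun u => gauge lam (f u) ξ with hE
  have hE0 : ∀ u, 0 < E u := fun u => lt_of_le_of_ne (gauge_nonneg _ _) fun h =>
    hne u ((gauge_eq_zero_iff hpos).1 h.symm)
  have hla : (0 : ℝ) < lam a := by exact_mod_cast hpos a
  have hα : (0 : ℝ) < (lam a : ℝ)⁻¹ := inv_pos.2 hla
  -- local Lipschitz estimate
  have local_bound : ∀ u, ∀ᶠ w in 𝓝 u,
      gauge lam (f w) (f u) ≤ 2 * C * E u ^ 2 * |w - u| ^ ((lam a : ℝ)⁻¹) := by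
    intro u
    have ht : Tendsto (fun w => C * E u * |w - u| ^ ((lam a : ℝ)⁻¹)) (𝓝 u) (𝓝 0) := by
      have : Continuous fun w => C * E u * |w - u| ^ ((lam a : ℝ)⁻¹) :=
        continuous_const.mul (Continuous.rpow_const (by fun_prop) fun _ => Or.inr hα.le)
      simpa [Real.zero_rpow hα.ne'] using this.tendsto u
    -- For w this close to u, `hup` gives gauge (f w) (f u) ≤ E w / 4. If that gauge were the larger
    -- term in the triangle inequality, then E w ≤ E w / 2; so E w ≤ 2 E u.
    filter_upwards [ht.eventually_lt_const (show (0 : ℝ) < 1 / 4 by norm_num)] with w hw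
    have h1 := hup w u
    have h2 : E w ≤ 2 * max (gauge lam (f w) (f u)) (E u) := gauge_triangle hpos _ _ _
    have hr : 0 ≤ |w - u| ^ ((lam a : ℝ)⁻¹) := by positivity
    have h3 : E w ≤ 2 * E u := by
      rcases le_total (gauge lam (f w) (f u)) (E u) with h | h
      · rwa [max_eq_right h] at h2
      · rw [max_eq_left h] at h2
        exfalso
        have : C * (E w * E u * |w - u| ^ ((lam a : ℝ)⁻¹)) ≤ E w * (1 / 4) := by
          rw [show C * (E w * E u * |w - u| ^ ((lam a : ℝ)⁻¹)) =
            E w * (C * E u * |w - u| ^ ((lam a : ℝ)⁻¹)) by ring]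
          exact mul_le_mul_of_nonneg_left hw.le (hE0 w).le
        have := hE0 w
        linarith
    refine h1.trans ?_
    have : E w * E u * |w - u| ^ ((lam a : ℝ)⁻¹) ≤ 2 * E u * E u * |w - u| ^ ((lam a : ℝ)⁻¹) :=
      mul_le_mul_of_nonneg_right (mul_le_mul_of_nonneg_right h3 (hE0 u).le) hr
    calc _ ≤ C * (2 * E u * E u * |w - u| ^ ((lam a : ℝ)⁻¹)) :=
          mul_le_mul_of_nonneg_left this hC0.le
      _ = _ := by ring
  have coord_bound : ∀ i u, ∀ᶠ w in 𝓝 u,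
      |f w i - f u i| ≤ (2 * C * E u ^ 2) ^ lam i * |w - u| ^ ((lam i : ℝ) / lam a) := by
    intro i u
    filter_upwards [local_bound u] with w hw
    refine (abs_sub_le_gauge_pow hpos (f w) (f u) i).trans
      ((pow_le_pow_left₀ (gauge_nonneg _ _) hw _).trans (le_of_eq ?_))
    rw [mul_pow, ← Real.rpow_natCast (|w - u| ^ _), ← Real.rpow_mul (abs_nonneg _)]
    ring_nf
  -- coordinates of larger weight are constant
  have hderiv : ∀ i, i ≠ a → ∀ u, HasDerivAt (fun w => f w i) 0 u := by
    intro i hi u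
    -- A local Hölder exponent above 1 forces zero derivative; this is where minimality of `lam a`
    -- is used.
    have hgt : (1 : ℝ) < (lam i : ℝ) / lam a := by
      rw [one_lt_div hla]; exact_mod_cast ha i hi
    rw [hasDerivAt_iff_isLittleO]
    simp only [smul_zero, sub_zero]
    have h1 : (fun w => f w i - f u i) =O[𝓝 u] fun w => |w - u| ^ ((lam i : ℝ) / lam a) := by
      refine Asymptotics.IsBigO.of_bound ((2 * C * E u ^ 2) ^ lam i) ?_
      filter_upwards [coord_bound i u] with w hw
      rwa [Real.norm_eq_abs, Real.norm_of_nonneg (by positivity)]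
    refine h1.trans_isLittleO ?_
    have h2 : Tendsto (fun w => |w - u| ^ ((lam i : ℝ) / lam a - 1)) (𝓝 u) (𝓝 0) := by
      have : Continuous fun w => |w - u| ^ ((lam i : ℝ) / lam a - 1) :=
        Continuous.rpow_const (by fun_prop) fun _ => Or.inr (by linarith)
      simpa [Real.zero_rpow (sub_pos.2 hgt).ne'] using this.tendsto u
    refine Asymptotics.isLittleO_iff.2 fun ε hε => ?_
    filter_upwards [h2.eventually_lt_const hε] with w hw
    rw [Real.norm_of_nonneg (by positivity), Real.norm_eq_abs]
    rcases eq_or_ne w u with rfl | hwu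
    · simp [Real.zero_rpow (zero_lt_one.trans hgt).ne']
    · have h0 : 0 < |w - u| := abs_pos.2 (sub_ne_zero.2 hwu)
      have : |w - u| ^ ((lam i : ℝ) / lam a) = |w - u| ^ ((lam i : ℝ) / lam a - 1) * |w - u| := by
        rw [← Real.rpow_add_one h0.ne', sub_add_cancel]
      rw [this]
      exact mul_le_mul_of_nonneg_right hw.le h0.le
  have hconst : ∀ i, i ≠ a → ∀ u w, f u i = f w i := fun i hi u w =>
    is_const_of_deriv_eq_zero (fun z => (hderiv i hi z).differentiableAt)
      (fun z => (hderiv i hi z).deriv) u w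
  -- the remaining coordinate is continuous and injective
  have hcont : Continuous fun u => f u a := by
    refine continuous_iff_continuousAt.2 fun u => ?_
    rw [ContinuousAt, tendsto_iff_dist_tendsto_zero]
    have h1 : Tendsto (fun w => (2 * C * E u ^ 2) ^ lam a * |w - u| ^ ((lam a : ℝ) / lam a))
        (𝓝 u) (𝓝 0) := by
      rw [div_self hla.ne']
      have : Continuous fun w => (2 * C * E u ^ 2) ^ lam a * |w - u| ^ (1 : ℝ) := by
        simp only [Real.rpow_one]; fun_prop
      simpa using this.tendsto u
    exact squeeze_zero' (Eventually.of_forall fun _ => dist_nonneg) (coord_bound a u) h1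
  have hinj : Function.Injective fun u => f u a := by
    intro u w huw
    by_contra hne
    have hfu : f u = f w := by
      funext i
      rcases eq_or_ne i a with rfl | hi
      · exact huw
      · exact hconst i hi u w
    have h1 := hlow u w
    rw [(gauge_eq_zero_iff hpos).2 hfu, mul_zero] at h1
    have h2 : 0 < |u - w| ^ ((lam a : ℝ)⁻¹) :=
      Real.rpow_pos_of_pos (abs_pos.2 (sub_ne_zero.2 hne)) _
    have := mul_pos (mul_pos (hE0 u) (hE0 w)) h2
    exact absurd h1 (not_le.2 this)
  -- both ends converge to `ξ`
  have hends : ∀ l : Filter ℝ, Tendsto (fun u : ℝ => |u|) l atTop →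
      Tendsto (fun u => f u a) l (𝓝 (ξ a)) := by
    intro l hl
    have hr : Tendsto (fun u : ℝ => |u| ^ ((lam a : ℝ)⁻¹)) l atTop :=
      (tendsto_rpow_atTop hα).comp hl
    have hEl : Tendsto E l (𝓝 0) := by
      have h1 : Tendsto (fun u : ℝ => 2 * C * E 0 / (E 0 * |u| ^ ((lam a : ℝ)⁻¹))) l (𝓝 0) :=
        tendsto_const_nhds.div_atTop (hr.const_mul_atTop (hE0 0))
      refine squeeze_zero' (Eventually.of_forall fun u => (hE0 u).le) ?_ h1
      -- Compare u with 0: E u · E 0 · |u| ^ (1 / lam a) ≤ 2 C max(E u, E 0). Past this threshold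
      -- the maximum cannot be E u, so E u decays.
      filter_upwards [hr.eventually_gt_atTop (2 * C / E 0)] with u hu
      have h2 := hlow u 0
      rw [sub_zero] at h2
      have h3 : gauge lam (f u) (f 0) ≤ 2 * max (E u) (E 0) := by
        have := gauge_triangle hpos (f u) ξ (f 0)
        rwa [gauge_comm ξ] at this
      rw [div_lt_iff₀ (hE0 0)] at hu
      have hr0 : 0 < |u| ^ ((lam a : ℝ)⁻¹) := by
        by_contra h
        nlinarith [hE0 0]
      rw [le_div_iff₀ (mul_pos (hE0 0) hr0), ← mul_assoc]
      have h4 : E u * E 0 * |u| ^ ((lam a : ℝ)⁻¹) ≤ C * (2 * max (E u) (E 0)) :=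
        h2.trans (mul_le_mul_of_nonneg_left h3 hC0.le)
      rcases le_total (E u) (E 0) with h | h
      · rw [max_eq_right h] at h4
        linarith
      · rw [max_eq_left h] at h4
        exfalso
        have := mul_lt_mul_of_pos_left hu (hE0 u)
        linarith
    rw [tendsto_iff_dist_tendsto_zero]
    have h5 : Tendsto (fun u => E u ^ lam a) l (𝓝 0) := by
      simpa [(hpos a).ne'] using hEl.pow (lam a)
    exact squeeze_zero (fun _ => dist_nonneg) (fun u => abs_sub_le_gauge_pow hpos (f u) ξ a) h5
  have htop := hends atTop tendsto_abs_atTop_atTop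
  have hbot := hends atBot tendsto_abs_atBot_atTop
  -- A continuous injection of ℝ is strictly monotone, so its limits at the two ends cannot both be
  -- ξ a.
  rcases hcont.strictMono_of_inj hinj with hm | hm
  · have h1 := hm.monotone.ge_of_tendsto htop 1
    have h2 := hm.monotone.le_of_tendsto hbot 0
    have h3 := hm zero_lt_one
    simp only at h1 h2 h3
    linarith
  · have h1 := hm.antitone.le_of_tendsto htop 1
    have h2 := hm.antitone.ge_of_tendsto hbot 0
    have h3 := hm zero_lt_one
    simp only at h1 h2 h3
    linarith

/-- Along all but at most one downward ray, the image under an inversion stays bounded. -/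
theorem apexAt_bounded_of_ne (hpos : ∀ i, 0 < lam i) (f : Twisted lam → Twisted lam)
    (ξ : Fin n → ℝ) {C : ℝ} (hC0 : 0 < C)
    (hlow : ∀ p q, apexAt ξ (f p) * apexAt ξ (f q) * apex p q ≤ C * apex (f p) (f q))
    {x y : Fin n → ℝ} (hxy : x ≠ y)
    (hx : ¬ ∃ M, ∀ t (ht : 0 < t), apexAt ξ (f (mk x t ht)) ≤ M) :
    ∃ M, ∀ t (ht : 0 < t), apexAt ξ (f (mk y t ht)) ≤ M := by
  have hg : 0 < gauge lam x y := lt_of_le_of_ne (gauge_nonneg _ _) fun h =>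
    hxy ((gauge_eq_zero_iff hpos).1 h.symm)
  simp only [not_exists, not_forall, not_le] at hx
  -- The estimates give A · B · gauge x y ≤ 2 C max(A, B), so the smaller of A and B is at most this
  -- threshold; here A exceeds it.
  obtain ⟨t, ht, hxt⟩ := hx (2 * C / gauge lam x y)
  refine ⟨2 * C / gauge lam x y, fun s hs => ?_⟩
  have h1 := hlow (mk x t ht) (mk y s hs)
  have h2 := apex_le_apexAt hpos ξ (f (mk x t ht)) (f (mk y s hs))
  have h3 := gauge_le_apex (mk x t ht : Twisted lam) (mk y s hs)
  rw [base_mk, base_mk] at h3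
  have p1 := apexAt_pos ξ (f (mk x t ht))
  have p2 := apexAt_pos ξ (f (mk y s hs))
  set A := apexAt ξ (f (mk x t ht))
  set B := apexAt ξ (f (mk y s hs))
  have h4 : A * B * gauge lam x y ≤ C * (2 * max A B) :=
    (mul_le_mul_of_nonneg_left h3 (by positivity)).trans
      (h1.trans (mul_le_mul_of_nonneg_left h2 hC0.le))
  rw [div_lt_iff₀ hg] at hxt
  rw [le_div_iff₀ hg]
  rcases le_total A B with h | h
  · rw [max_eq_right h] at h4
    exfalso
    have := mul_lt_mul_of_pos_right hxt p2
    nlinarith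
  · rw [max_eq_left h] at h4
    exact le_of_mul_le_mul_left (by linarith) p1

theorem gauge_update (hpos : ∀ i, 0 < lam i) (x : Fin n → ℝ) (a : Fin n) (u w : ℝ) :
    gauge lam (Function.update x a u) (Function.update x a w) = |u - w| ^ ((lam a : ℝ)⁻¹) := by
  have hla : (lam a : ℝ) ≠ 0 := by exact_mod_cast (hpos a).ne'
  refine le_antisymm ((gauge_le_iff hpos (by positivity)).2 fun i => ?_) ?_
  · rcases eq_or_ne i a with rfl | hi
    · rw [← Real.rpow_natCast, ← Real.rpow_mul (abs_nonneg _), inv_mul_cancel₀ hla,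
        Real.rpow_one]
      simp
    · simp only [Function.update_of_ne hi, sub_self, abs_zero]
      positivity
  · have := norm_le_pi_norm (fun i => |Function.update x a u i - Function.update x a w i| ^
      ((lam i : ℝ)⁻¹)) a
    simp only [Function.update_self] at this
    rwa [Real.norm_of_nonneg (by positivity)] at this

/-- An inversion-like self-map does not exist when `n ≥ 2` and one weight is strictly the
smallest. -/
theorem not_exists_inversion (hpos : ∀ i, 0 < lam i) {a b : Fin n} (hab : b ≠ a)
    (ha : ∀ i, i ≠ a → lam a < lam i) (f : Twisted lam → Twisted lam) (ξ : Fin n → ℝ) {C : ℝ}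
    (hC : 1 ≤ C) (hh : ∀ p, (f p).height ≤ C * (apexAt ξ (f p) ^ 2 * p.height))
    (hup : ∀ p q, apex (f p) (f q) ≤ C * (apexAt ξ (f p) * apexAt ξ (f q) * apex p q))
    (hlow : ∀ p q, apexAt ξ (f p) * apexAt ξ (f q) * apex p q ≤ C * apex (f p) (f q)) :
    False := by
  have hC0 : 0 < C := by linarith
  -- along all but one downward ray, `apexAt ξ` stays bounded
  let Bdd : (Fin n → ℝ) → Prop := fun x =>
    ∃ M, ∀ t (ht : 0 < t), apexAt ξ (f (mk x t ht)) ≤ M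
  have hBdd : ∀ x y, x ≠ y → ¬ Bdd x → Bdd y := fun x y hxy hx =>
    apexAt_bounded_of_ne hpos f ξ hC0 hlow hxy hx
  -- a line avoiding the exceptional ray
  have hline : ∃ r : ℝ, ∀ u, Bdd (Function.update (fun _ => r) a u) := by
    by_cases h : ∀ u, Bdd (Function.update (fun _ => (0 : ℝ)) a u)
    · exact ⟨0, h⟩
    · push Not at h
      obtain ⟨u, hu⟩ := h
      -- The lines r = 0 and r = 1 differ in coordinate `b`, so the second misses the exceptional
      -- point.
      refine ⟨1, fun w => hBdd _ _ (fun e => ?_) hu⟩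
      have := congrFun e b
      simp [Function.update_of_ne hab] at this
  obtain ⟨r, hr⟩ := hline
  let X : ℝ → Fin n → ℝ := fun u => Function.update (fun _ => r) a u
  have hX : ∀ u w, gauge lam (X u) (X w) = |u - w| ^ ((lam a : ℝ)⁻¹) :=
    gauge_update hpos _ a
  -- boundary values on that line
  have hlim : ∀ u, ∃ (y : Fin n → ℝ) (t : ℕ → ℝ) (ht : ∀ k, 0 < t k), Tendsto t atTop (𝓝 0) ∧
      Tendsto (fun k => (f (mk (X u) (t k) (ht k))).base) atTop (𝓝 y) ∧
      Tendsto (fun k => (f (mk (X u) (t k) (ht k))).height) atTop (𝓝 0) := by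
    intro u
    obtain ⟨M, hM⟩ := hr u
    let t : ℕ → ℝ := fun k => 1 / ((k : ℝ) + 1)
    have ht : ∀ k, 0 < t k := fun k => by positivity
    have ht0 : Tendsto t atTop (𝓝 0) := tendsto_one_div_add_atTop_nhds_zero_nat
    obtain ⟨y, -, φ, hφ, hy⟩ := tendsto_subseq_of_bounded (isBounded_gauge_le hpos ξ M)
      (x := fun k => (f (mk (X u) (t k) (ht k))).base)
      (fun k => (le_max_right _ _).trans (hM (t k) (ht k)))
    refine ⟨y, t ∘ φ, fun k => ht _, ht0.comp hφ.tendsto_atTop, hy, ?_⟩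
    -- By `hh` the image heights are at most C M² t, so the limit lies on the boundary.
    have h1 : Tendsto (fun k => C * (M ^ 2 * t (φ k))) atTop (𝓝 0) := by
      simpa using ((ht0.comp hφ.tendsto_atTop).const_mul (M ^ 2)).const_mul C
    refine squeeze_zero (fun k => (f _).height_pos.le) (fun k => (hh _).trans ?_) h1
    refine mul_le_mul_of_nonneg_left (mul_le_mul_of_nonneg_right ?_ (ht _).le) hC0.le
    exact pow_le_pow_left₀ (apexAt_pos _ _).le (hM _ _) 2
  choose F t ht ht0 hbase hheight using hlim
  have hA : ∀ u, Tendsto (fun k => apexAt ξ (f (mk (X u) (t u k) (ht u k)))) atTop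
      (𝓝 (gauge lam (F u) ξ)) := by
    intro u
    have := tendsto_apexAt (lam := lam) ξ (hbase u) (hheight u)
    rwa [max_eq_right (gauge_nonneg _ _)] at this
  have hT : ∀ u w, Tendsto (fun k => apex (f (mk (X u) (t u k) (ht u k)))
      (f (mk (X w) (t w k) (ht w k)))) atTop (𝓝 (gauge lam (F u) (F w))) := by
    intro u w
    have := tendsto_apex (lam := lam) (hbase u) (hheight u) (hbase w) (hheight w)
    rwa [max_self, max_eq_right (gauge_nonneg _ _)] at this
  have hS : ∀ u w, Tendsto (fun k => apex (mk (X u) (t u k) (ht u k) : Twisted lam)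
      (mk (X w) (t w k) (ht w k))) atTop (𝓝 (|u - w| ^ ((lam a : ℝ)⁻¹))) := by
    intro u w
    have := tendsto_apex (lam := lam) (p := fun k => mk (X u) (t u k) (ht u k))
      (q := fun k => mk (X w) (t w k) (ht w k)) (x := X u) (y := X w)
      tendsto_const_nhds (ht0 u) tendsto_const_nhds
      (ht0 w)
    rwa [max_self, max_eq_right (gauge_nonneg _ _), hX] at this
  refine not_exists_inverted_line hpos ha F ξ hC (fun u hu => ?_) (fun u w => ?_) fun u w => ?_
  -- If F u were ξ, `hup` against any fixed point q would force the height of f q to be at most 0 in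
  -- the limit.
  · let q : Twisted lam := 1
    have h1 : Tendsto (fun k => C * (apexAt ξ (f (mk (X u) (t u k) (ht u k))) * apexAt ξ (f q) *
        apex (mk (X u) (t u k) (ht u k)) q)) atTop
        (𝓝 (C * (gauge lam (F u) ξ * apexAt ξ (f q) *
          max (max 0 q.height) (gauge lam (X u) q.base)))) := by
      refine (((hA u).mul_const _).mul ?_).const_mul C
      exact tendsto_apex (lam := lam) (p := fun k => mk (X u) (t u k) (ht u k))
        (q := fun _ => q) tendsto_const_nhds (ht0 u) tendsto_const_nhds tendsto_const_nhds
    rw [(gauge_eq_zero_iff hpos).2 hu, zero_mul, zero_mul, mul_zero] at h1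
    have h2 := ge_of_tendsto h1 (Eventually.of_forall fun k =>
      (height_le_apex_right _ _).trans (hup (mk (X u) (t u k) (ht u k)) q))
    exact absurd h2 (not_le.2 (f q).height_pos)
  · exact le_of_tendsto_of_tendsto' (hT u w)
      ((((hA u).mul (hA w)).mul (hS u w)).const_mul C) fun k => hup _ _
  · exact le_of_tendsto_of_tendsto' (((hA u).mul (hA w)).mul (hS u w))
      ((hT u w).const_mul C) fun k => hlow _ _

/-! ### Coarse invariance of height ratios -/

/-- Maps that coarsely preserve the distance coarsely preserve the ratios of heights. -/
theorem CoarselyPreserves.height_mul_height_le (hpos : ∀ i, 0 < lam i) {a b : Fin n} (hab : b ≠ a)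
    (ha : ∀ i, i ≠ a → lam a < lam i) {K : ℝ} (hK : 1 ≤ K) {f : Twisted lam → Twisted lam}
    (hf : CoarselyPreserves K f) (p q : Twisted lam) :
    (f p).height * q.height ≤ 4 * K ^ 6 * (p.height * (f q).height) := by
  have hK0 : 0 < K := by linarith
  have rises : ∀ x u v (hu : 0 < u) (hv : 0 < v), u ≤ v →
      (f (mk x u hu)).height * v ≤ 4 * K ^ 4 * ((f (mk x v hv)).height * u) := by
    intro x u v hu hv huv
    by_contra hcon
    -- If the image fails to rise between u and v, it falls at every w ≥ v, which produces a
    -- forbidden inversion.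
    obtain ⟨ξ, C, hC, h1, h2, h3⟩ := hf.exists_inversion hpos hK x hv fun w hw =>
      (hf.rises_or_falls hpos hK0 x hu hv (hv.trans_le hw) huv hw).resolve_left hcon
    exact not_exists_inversion hpos hab ha f ξ hC h1 h2 h3
  -- Chain three comparisons: from `p` up to height s, across to the ray of `q` (where `expDist` is
  -- 1), and down to `q`. They cost 4 K⁴, K and K.
  set s := max (max p.height q.height) (gauge lam p.base q.base) with hs
  have hps : p.height ≤ s := (le_max_left _ _).trans (le_max_left _ _)
  have hqs : q.height ≤ s := (le_max_right _ _).trans (le_max_left _ _)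
  have hs0 : 0 < s := p.height_pos.trans_le hps
  have h1 := rises p.base p.height s p.height_pos hs0 hps
  have h2 := (hf.height_mul_le hpos q.base q.height_pos hs0 hqs).2
  have h3 := hf.apex_sq_le (mk p.base s hs0) (mk q.base s hs0)
  rw [expDist_mk_of_le (p := mk p.base s hs0) hs0 le_rfl (le_max_right _ _), height_mk,
    div_self hs0.ne', mul_one] at h3
  change (f p).height * s ≤ _ at h1
  change _ ≤ K * ((f q).height * s) at h2
  have P := (f (mk p.base s hs0)).height_pos
  have Q := (f (mk q.base s hs0)).height_pos
  have h4 := pow_le_pow_left₀ P.le (height_le_apex_left (f (mk p.base s hs0))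
    (f (mk q.base s hs0))) 2
  set A := (f (mk p.base s hs0)).height
  set B := (f (mk q.base s hs0)).height
  have h5 : A ≤ K * B := by
    have := h4.trans h3
    exact le_of_mul_le_mul_left (by linarith) P
  have hp := p.height_pos
  have hq := q.height_pos
  refine le_of_mul_le_mul_right (a := s) ?_ hs0
  calc (f p).height * q.height * s = (f p).height * s * q.height := by ring
    _ ≤ 4 * K ^ 4 * (A * p.height) * q.height := mul_le_mul_of_nonneg_right h1 hq.le
    _ = 4 * K ^ 4 * p.height * q.height * A := by ring
    _ ≤ 4 * K ^ 4 * p.height * q.height * (K * B) := mul_le_mul_of_nonneg_left h5 (by positivity)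
    _ = 4 * K ^ 5 * p.height * (B * q.height) := by ring
    _ ≤ 4 * K ^ 5 * p.height * (K * ((f q).height * s)) :=
        mul_le_mul_of_nonneg_left h2 (by positivity)
    _ = _ := by ring

/-! ### Orbits: local finiteness and nets -/

theorem height_le_expDist_mul (p q : Twisted lam) : p.height ≤ expDist p q * q.height := by
  have h := pow_le_pow_left₀ p.height_pos.le (height_le_apex_left p q) 2
  rw [apex_sq] at h
  exact le_of_mul_le_mul_left (by linarith) p.height_pos

/-- Used for points high above 1: their apex with 1 is comparable to their height, so they are close
to one another. -/
theorem expDist_le_of_apex_one_sq_le (hpos : ∀ i, 0 < lam i) {p q : Twisted lam} {A B : ℝ}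
    (hp : apex 1 p ^ 2 ≤ A) (hq : apex 1 q ^ 2 ≤ A) (hp' : 1 ≤ B * p.height)
    (hq' : 1 ≤ B * q.height) : expDist p q ≤ 4 * A * B ^ 2 := by
  have tri := apex_triangle hpos p 1 q
  rw [apex_comm p 1] at tri
  have hA0 : 0 ≤ A := (sq_nonneg _).trans hp
  have hA : apex p q ^ 2 ≤ 4 * A := by
    have h0 := pow_le_pow_left₀ (apex_pos p q).le tri 2
    rcases max_choice (apex 1 p) (apex 1 q) with h | h
    · rw [h] at h0; linarith
    · rw [h] at h0; linarith
  have hpq := mul_pos p.height_pos q.height_pos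
  have h1 : 1 ≤ B ^ 2 * (p.height * q.height) := by
    refine (one_le_mul_of_one_le_of_one_le hp' hq').trans (le_of_eq (by ring))
  unfold expDist
  rw [div_le_iff₀ hpq]
  calc apex p q ^ 2 ≤ 4 * A * 1 := by linarith
    _ ≤ 4 * A * (B ^ 2 * (p.height * q.height)) :=
        mul_le_mul_of_nonneg_left h1 (by positivity)
    _ = _ := by ring

theorem isCompact_coords_preimage {s : Set (Fin n → ℝ)} (hs : IsCompact s) {r : ℝ} (hr : 0 < r)
    (R : ℝ) : IsCompact {p : Twisted lam | p.base ∈ s ∧ p.height ∈ Icc r R} := by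
  have hemb : Topology.IsEmbedding (coords : Twisted lam → _) := Topology.IsEmbedding.subtypeVal
  rw [hemb.isCompact_iff]
  convert hs.prod (isCompact_Icc (a := r) (b := R)) using 1
  ext ⟨x, t⟩
  constructor
  · rintro ⟨p, hp, h⟩
    rw [← h]
    exact hp
  · rintro ⟨hx, ht⟩
    exact ⟨mk x t (hr.trans_le ht.1), ⟨hx, ht⟩, rfl⟩

theorem isCompact_gauge_le (hpos : ∀ i, 0 < lam i) (z : Fin n → ℝ) (r : ℝ) :
    IsCompact {y | gauge lam y z ≤ r} := by
  have h : Continuous fun y : Fin n → ℝ => (y, z) := by fun_prop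
  have hc := (continuous_gauge (lam := lam)).comp h
  exact Metric.isCompact_of_isClosed_isBounded (isClosed_le hc continuous_const)
    (isBounded_gauge_le hpos z r)

/-- A ball of `expDist` about 1 lies in a compact box: heights in [r⁻¹, r] and gauge at most r. -/
theorem finite_setOf_expDist_le (hpos : ∀ i, 0 < lam i) {G : Type*} [Group G]
    [MulAction G (Twisted lam)] [ProperlyDiscontinuousSMul G (Twisted lam)] (r : ℝ) :
    {γ : G | expDist 1 (γ • (1 : Twisted lam)) ≤ r}.Finite := by
  rcases lt_or_ge r 1 with hr | hr
  · convert finite_empty (α := G)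
    exact eq_empty_iff_forall_notMem.2 fun γ hγ =>
      absurd (one_le_expDist 1 (γ • (1 : Twisted lam))) (not_le.2 (lt_of_le_of_lt hγ hr))
  have hr0 : 0 < r := by linarith
  have hL := isCompact_coords_preimage (lam := lam)
    (isCompact_gauge_le hpos (1 : Twisted lam).base r) (inv_pos.2 hr0) r
  refine (ProperlyDiscontinuousSMul.finite_disjoint_inter_image (Γ := G)
    (isCompact_singleton (x := (1 : Twisted lam))) hL).subset fun γ hγ => ?_
  refine ⟨γ • 1, ⟨1, rfl, rfl⟩, ?_⟩
  have hγ' : expDist 1 (γ • (1 : Twisted lam)) ≤ r := hγ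
  set p := γ • (1 : Twisted lam)
  have h1 := height_le_expDist_mul 1 p
  have h2 := height_le_expDist_mul p 1
  rw [expDist_comm] at h2
  rw [height_one] at h1 h2
  have hp := p.height_pos
  have h3 : p.height ≤ r := by linarith
  refine ⟨?_, ?_, h3⟩
  · have h4 := pow_le_pow_left₀ (gauge_nonneg _ _) (gauge_le_apex 1 p) 2
    rw [apex_sq, height_one, one_mul, gauge_comm] at h4
    refine le_of_sq_le_sq (h4.trans ?_) hr0.le
    rw [sq]
    exact mul_le_mul hγ' h3 hp.le hr0.le
  · rw [inv_le_iff_one_le_mul₀ hr0]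
    nlinarith

/-- The k-neighbourhoods of the orbit of 1 are open, invariant and increasing, so their images cover
the compact quotient and one of them is everything. -/
theorem exists_orbit_net {g : SmoothRiemannianMetric ((Fin n → ℝ) × ℝ) (Twisted lam)}
    {G : Type*} [Group G] [MulAction G (Twisted lam)] (h : IsCocompactIsometricAction g G)
    (hfin : ∀ p q : Twisted lam, riemannianDistOf g p q ≠ ⊤) :
    ∃ R : ℕ, ∀ p : Twisted lam, ∃ γ : G, riemannianDistOf g (γ • 1) p < R := by
  let U : ℕ → Set (Twisted lam) := fun k => {p | ∃ γ : G, riemannianDistOf g (γ • 1) p < k}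
  have hUo : ∀ k, IsOpen (U k) := by
    intro k
    rw [isOpen_iff_mem_nhds]
    rintro p ⟨γ, hγ⟩
    filter_upwards [eventually_riemannianDistOf_lt g p (tsub_pos_of_lt hγ)] with q hq
    refine ⟨γ, (riemannianDistOf_triangle g _ p q).trans_lt ?_⟩
    exact lt_tsub_iff_left.1 hq
  have hinv : ∀ k (δ : G) p, p ∈ U k → δ • p ∈ U k := by
    rintro k δ p ⟨γ, hγ⟩
    refine ⟨δ * γ, ?_⟩
    rwa [mul_smul, h.isometric]
  let proj : Twisted lam → MulAction.orbitRel.Quotient G (Twisted lam) := Quotient.mk _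
  have hsat : ∀ k, proj ⁻¹' (proj '' U k) = U k := by
    intro k
    refine Subset.antisymm ?_ (subset_preimage_image _ _)
    rintro p ⟨q, hq, hqp⟩
    obtain ⟨δ, hδ⟩ : q ∈ MulAction.orbit G p := Quotient.exact hqp
    have hδ' : δ • p = q := hδ
    have := hinv k δ⁻¹ q hq
    rwa [← hδ', inv_smul_smul] at this
  have hVo : ∀ k, IsOpen (proj '' U k) := fun k => by
    have : IsOpen (proj ⁻¹' (proj '' U k)) := by rw [hsat]; exact hUo k
    exact isOpen_coinduced.2 this
  have hmono : Monotone fun k => proj '' U k := by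
    intro k l hkl
    refine image_mono ?_
    rintro p ⟨γ, hγ⟩
    exact ⟨γ, hγ.trans_le (by exact_mod_cast hkl)⟩
  have := h.cocompact
  obtain ⟨R, hR⟩ := isCompact_univ.elim_directed_cover (fun k => proj '' U k) hVo
    (by
      intro x _
      obtain ⟨p, rfl⟩ := Quotient.exists_rep x
      obtain ⟨k, hk⟩ := ENNReal.exists_nat_gt (hfin 1 p)
      exact mem_iUnion.2 ⟨k, p, ⟨1, by rwa [one_smul]⟩, rfl⟩) hmono.directed_le
  refine ⟨R, fun p => ?_⟩
  have hp : p ∈ proj ⁻¹' (proj '' U R) := hR (mem_univ (proj p))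
  rwa [hsat] at hp

/-! ### Counting orbit points below and above the identity -/

/-- If `γ • 1` is close to a point of height `ε` below `1`, then `γ⁻¹ • 1` is close to the point
above `1` of height `1 / ε`. -/
theorem inv_smul_one_bounds (hpos : ∀ i, 0 < lam i) {G : Type*} [Group G]
    [MulAction G (Twisted lam)] {K H R : ℝ} (hK : 1 ≤ K) (hH : 1 ≤ H) (hR : 1 ≤ R)
    (hcp : ∀ γ : G, CoarselyPreserves K fun p : Twisted lam => γ • p)
    (hheight : ∀ (γ : G) (p q : Twisted lam),
      (γ • p).height * q.height ≤ H * (p.height * (γ • q).height))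
    {ε : ℝ} (hε0 : 0 < ε) {z : Twisted lam} (hzε : z.height = ε) (hz : expDist z 1 = 1 / ε)
    {γ : G} (hγ : expDist (γ • 1) z ≤ R) :
    apex 1 (γ⁻¹ • (1 : Twisted lam)) ^ 2 ≤ 4 * K * H * R ^ 2 / ε ^ 2 ∧
      1 ≤ H * (R * ε) * (γ⁻¹ • (1 : Twisted lam)).height := by
  have w0 := (γ⁻¹ • (1 : Twisted lam)).height_pos
  have v0 := (γ • (1 : Twisted lam)).height_pos
  -- The element γ⁻¹ carries the pair (γ • 1, 1) to (1, γ⁻¹ • 1). As γ • 1 has height about ε,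
  -- bounded distortion of height ratios puts γ⁻¹ • 1 at height about 1/ε.
  have hcp1 := (hcp γ⁻¹ (γ • 1) 1).1
  have low := hheight γ⁻¹ (γ • 1) 1
  have high := hheight γ⁻¹ 1 (γ • 1)
  simp only [inv_smul_smul, height_one, mul_one] at hcp1 low high
  have h2 : (γ • (1 : Twisted lam)).height ≤ R * ε := by
    rw [← hzε]
    exact (height_le_expDist_mul _ z).trans (mul_le_mul_of_nonneg_right hγ z.height_pos.le)
  have h3 : ε ≤ R * (γ • (1 : Twisted lam)).height := by
    have := height_le_expDist_mul z (γ • (1 : Twisted lam))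
    rw [expDist_comm, hzε] at this
    exact this.trans (mul_le_mul_of_nonneg_right hγ v0.le)
  have h4 : expDist (γ • (1 : Twisted lam)) 1 ≤ 4 * (R * (1 / ε)) := by
    have := expDist_triangle hpos (γ • (1 : Twisted lam)) z 1
    rw [hz] at this
    exact this.trans (mul_le_mul_of_nonneg_left
      (mul_le_mul_of_nonneg_right hγ (by positivity)) (by norm_num))
  constructor
  · rw [le_div_iff₀ (by positivity), apex_sq, height_one, one_mul]
    have h5 : (γ⁻¹ • (1 : Twisted lam)).height * ε ≤ H * R := by
      calc _ ≤ (γ⁻¹ • (1 : Twisted lam)).height * (R * (γ • (1 : Twisted lam)).height) :=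
            mul_le_mul_of_nonneg_left h3 w0.le
        _ = ((γ⁻¹ • (1 : Twisted lam)).height * (γ • (1 : Twisted lam)).height) * R := by ring
        _ ≤ _ := mul_le_mul_of_nonneg_right high (by linarith)
    have h6 := hcp1.trans (mul_le_mul_of_nonneg_left h4 (by linarith))
    calc expDist 1 (γ⁻¹ • (1 : Twisted lam)) * (γ⁻¹ • (1 : Twisted lam)).height * ε ^ 2
        ≤ K * (4 * (R * (1 / ε))) * (γ⁻¹ • (1 : Twisted lam)).height * ε ^ 2 :=
          mul_le_mul_of_nonneg_right (mul_le_mul_of_nonneg_right h6 w0.le) (sq_nonneg ε)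
      _ = 4 * K * R * ((γ⁻¹ • (1 : Twisted lam)).height * ε) := by field_simp
      _ ≤ 4 * K * R * (H * R) := mul_le_mul_of_nonneg_left h5 (by positivity)
      _ = _ := by ring
  · calc (1 : ℝ) ≤ _ := low
      _ ≤ H * (R * ε * (γ⁻¹ • (1 : Twisted lam)).height) :=
        mul_le_mul_of_nonneg_left (mul_le_mul_of_nonneg_right h2 w0.le) (by linarith)
      _ = _ := by ring

/-- A discrete group whose elements coarsely preserve ratios of heights has no orbit that is a
net: downwards there are arbitrarily many orbit points within a given distance, upwards there are
not. -/
theorem not_exists_orbit_net (hpos : ∀ i, 0 < lam i) (a : Fin n) {G : Type*} [Group G]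
    [MulAction G (Twisted lam)] {K H R : ℝ} (hK : 1 ≤ K) (hH : 1 ≤ H) (hR : 1 ≤ R)
    (hcp : ∀ γ : G, CoarselyPreserves K fun p : Twisted lam => γ • p)
    (hheight : ∀ (γ : G) (p q : Twisted lam),
      (γ • p).height * q.height ≤ H * (p.height * (γ • q).height))
    (hnet : ∀ p : Twisted lam, ∃ γ : G, expDist (γ • 1) p ≤ R)
    (hfin : ∀ r, {γ : G | expDist 1 (γ • (1 : Twisted lam)) ≤ r}.Finite) : False := by
  -- This radius involves neither J nor ε, so S is fixed before J is taken to be one more than its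
  -- size.
  set r := K * (16 * K * H ^ 3 * R ^ 4) with hr
  set S := (hfin r).toFinset with hS
  set J := S.card + 1 with hJ
  have hJ0 : (1 : ℝ) ≤ J := by exact_mod_cast Nat.succ_pos _
  have hJp : (0 : ℝ) < J := by linarith
  have hla : (1 : ℝ) ≤ lam a := by exact_mod_cast hpos a
  have hα0 : (0 : ℝ) ≤ (lam a : ℝ)⁻¹ := by positivity
  have hα1 : (lam a : ℝ)⁻¹ ≤ 1 := inv_le_one_of_one_le₀ hla
  -- Points of height ε whose bases are 1/J apart in gauge have `expDist` at least (2 R + 1)² > 4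
  -- R². By `expDist_triangle`, no orbit point is then R-close to two of them.
  set ε : ℝ := 1 / (J * (2 * R + 1)) with hε
  have hε0 : 0 < ε := by positivity
  have hε1 : ε ≤ 1 := by
    rw [hε, div_le_one (by positivity)]
    nlinarith
  let x : Fin J → Fin n → ℝ := fun j => Function.update 0 a ((j : ℝ) / J)
  let z : Fin J → Twisted lam := fun j => mk (x j) ε hε0
  have hz : ∀ j, expDist (z j) 1 = 1 / ε := by
    intro j
    refine expDist_mk_of_le (x := 0) one_pos hε1 ?_
    have e : (0 : Fin n → ℝ) = Function.update (0 : Fin n → ℝ) a 0 :=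
      (Function.update_eq_self a (0 : Fin n → ℝ)).symm
    change gauge lam (x j) 0 ≤ 1
    rw [e]
    simp only [x]
    rw [gauge_update hpos, sub_zero]
    refine Real.rpow_le_one (abs_nonneg _) ?_ hα0
    rw [abs_of_nonneg (by positivity), div_le_one hJp]
    exact_mod_cast j.2.le
  have hzz : ∀ i j, i ≠ j → 4 * (R * R) < expDist (z i) (z j) := by
    intro i j hij
    have h1 : 1 / (J : ℝ) ≤ gauge lam (x i) (x j) := by
      simp only [x]
      rw [gauge_update hpos, ← sub_div, abs_div, abs_of_pos hJp]
      have h2 : (1 : ℝ) ≤ |(i : ℝ) - j| := by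
        have : (1 : ℤ) ≤ |(i : ℤ) - j| := Int.one_le_abs (by
          have := Fin.val_ne_of_ne hij
          omega)
        exact_mod_cast this
      have h3 : 1 / (J : ℝ) ≤ |(i : ℝ) - j| / J := div_le_div_of_nonneg_right h2 hJp.le
      refine le_trans ?_ (Real.rpow_le_rpow (by positivity) h3 hα0)
      exact Real.self_le_rpow_of_le_one (by positivity) ((div_le_one hJp).2 hJ0) hα1
    have h4 : 1 / (J : ℝ) ≤ apex (z i) (z j) := h1.trans (gauge_le_apex (z i) (z j))
    have h5 := pow_le_pow_left₀ (by positivity) h4 2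
    unfold expDist
    change _ < _ / (ε * ε)
    rw [lt_div_iff₀ (by positivity)]
    refine lt_of_lt_of_le ?_ h5
    have e : ε = 1 / J * (1 / (2 * R + 1)) := by rw [hε]; field_simp
    have h6 : 4 * (R * R) * ((1 / (2 * R + 1)) * (1 / (2 * R + 1))) < 1 := by
      rw [div_mul_div_comm, one_mul, mul_one_div, div_lt_one (by positivity)]
      nlinarith
    calc 4 * (R * R) * (ε * ε)
        = (1 / J) ^ 2 * (4 * (R * R) * ((1 / (2 * R + 1)) * (1 / (2 * R + 1)))) := by rw [e]; ring
      _ < (1 / J) ^ 2 * 1 := mul_lt_mul_of_pos_left h6 (by positivity)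
      _ = _ := mul_one _
  choose γ hγ using fun j => hnet (z j)
  have hinj : Function.Injective γ := by
    intro i j hij
    by_contra hne
    have h1 := expDist_triangle hpos (z i) (γ i • 1) (z j)
    rw [expDist_comm (z i) (γ i • 1)] at h1
    have h2 := hγ j
    rw [← hij] at h2
    have h3 : expDist (γ i • 1) (z i) * expDist (γ i • 1) (z j) ≤ R * R :=
      mul_le_mul (hγ i) h2 (expDist_pos _ _).le (by linarith)
    linarith [hzz i j hne]
  have hinv := fun j => inv_smul_one_bounds hpos hK hH hR hcp hheight hε0
    (z := z j) rfl (hz j) (hγ j)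
  -- In 4 A B², with A = 4 K H R² / ε² and B = H R ε, the powers of ε cancel.
  have hclose : ∀ i j, expDist ((γ i)⁻¹ • (1 : Twisted lam)) ((γ j)⁻¹ • 1) ≤
      16 * K * H ^ 3 * R ^ 4 := by
    intro i j
    refine (expDist_le_of_apex_one_sq_le hpos (hinv i).1 (hinv j).1 (hinv i).2
      (hinv j).2).trans (le_of_eq ?_)
    have : ε ≠ 0 := hε0.ne'
    clear_value ε
    field_simp
    norm_num
  let j₀ : Fin J := ⟨0, Nat.succ_pos _⟩
  -- Applying γ j₀ moves the cluster of points (γ j)⁻¹ • 1 back to 1, giving J distinct elements in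
  -- a set of J − 1.
  have hmaps : ∀ j, γ j₀ * (γ j)⁻¹ ∈ S := by
    intro j
    rw [hS, Set.Finite.mem_toFinset]
    have h1 := (hcp (γ j₀) ((γ j₀)⁻¹ • 1) ((γ j)⁻¹ • 1)).1
    simp only [smul_inv_smul] at h1
    rw [← mul_smul] at h1
    exact h1.trans (mul_le_mul_of_nonneg_left (hclose j₀ j) (by linarith))
  have hcard := Finset.card_le_card_of_injOn (s := Finset.univ) (t := S)
    (fun j => γ j₀ * (γ j)⁻¹) (fun j _ => hmaps j)
    (fun i _ j _ hij => hinj (inv_injective (mul_left_cancel hij)))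
  rw [Finset.card_univ, Fintype.card_fin] at hcard
  omega

end Twisted

end

theorem mainTheorem10 {n : ℕ} (hn : 2 ≤ n) (lam : Fin n → ℕ)
    (hpos : ∀ i, 0 < lam i) (hdistinct : Function.Injective lam)
    (g : SmoothRiemannianMetric ((Fin n → ℝ) × ℝ) (Twisted lam))
    (hg : IsLeftInvariantMetric g)
    (G : Type*) [Group G] [MulAction G (Twisted lam)] :
    ¬ IsCocompactIsometricAction g G := by
  intro h
  have : Nontrivial (Fin n) := Fin.nontrivial_iff_two_le.2 hn
  obtain ⟨a, hmin⟩ := Finite.exists_min lam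
  obtain ⟨b, hab⟩ := exists_ne a
  have ha : ∀ i, i ≠ a → lam a < lam i := fun i hi =>
    lt_of_le_of_ne (hmin i) fun e => hi (hdistinct e.symm)
  obtain ⟨c, K, hc, hK, hd⟩ := Twisted.exists_expDist_bounds hpos g hg
  have hK0 : 0 < K := by linarith
  have hKK : 1 ≤ K * K := one_le_mul_of_one_le_of_one_le hK hK
  -- An isometry leaves exp (d / c) unchanged, and passing from `expDist` to it and back costs a
  -- factor K each way.
  have hcp : ∀ γ : G, Twisted.CoarselyPreserves (K * K) fun p : Twisted lam => γ • p := by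
    intro γ p q
    have h1 := hd p q
    have h2 := hd (γ • p) (γ • q)
    rw [h.isometric] at h2
    exact ⟨(h2.2.1.trans (mul_le_mul_of_nonneg_left h1.2.2 hK0.le)).trans
      (le_of_eq (mul_assoc _ _ _).symm),
      (h1.2.1.trans (mul_le_mul_of_nonneg_left h2.2.2 hK0.le)).trans
      (le_of_eq (mul_assoc _ _ _).symm)⟩
  obtain ⟨R, hR⟩ := Twisted.exists_orbit_net h fun p q => (hd p q).1
  have := h.properlyDiscontinuous
  have hexp : 1 ≤ Real.exp (R / c) := Real.one_le_exp (by positivity)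
  refine Twisted.not_exists_orbit_net hpos a (K := K * K) (H := 4 * (K * K) ^ 6)
    (R := K * Real.exp (R / c)) hKK ?_ (one_le_mul_of_one_le_of_one_le hK hexp) hcp
    (fun γ p q => (hcp γ).height_mul_height_le hpos hab ha hKK p q) (fun p => ?_)
    (fun r => Twisted.finite_setOf_expDist_le hpos r)
  · have := one_le_pow₀ hKK (n := 6)
    linarith
  · obtain ⟨γ, hγ⟩ := hR p
    refine ⟨γ, (hd _ _).2.1.trans (mul_le_mul_of_nonneg_left (Real.exp_le_exp.2 ?_) hK0.le)⟩
    refine div_le_div_of_nonneg_right ?_ hc.le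
    simpa using ENNReal.toReal_mono (ENNReal.natCast_ne_top R) hγ.le
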